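/- Let $\mathbb K$ be a field and let $\mathbf{Op}$ be the category of finitely generated binary quadratic symmetric operads in $\mathbb K$-vector spaces (operads of the form $\mathcal F(E)/(R)$, with $E$ a finite dimensional $\mathbb K[S_2]$-module of binary generators and $R\subset\mathcal F(E)(3)$), with all morphisms of operads. For a vector space $V$ let $C^*(\Delta_1;V)=C^*(\Delta_1;\mathbb K)\otimes V$ be the complex of non-degenerate cochains of the $1$-simplex with coefficients in $V$, concentrated in degrees $0$ and $1$. If $V$ is an algebra over $\mathcal O\in\mathbf{Op}$, every $\mu\in\mathcal O(2)$ gives a cup product $\cup\otimes\mu$ on $C^*(\Delta_1;V)$, the tensor product of the usual cup product of $C^*(\Delta_1;\mathbb K)$ and of $\mu$. A dg algebra structure over an operad on $C^*(\Delta_1;V)$ is called local if for every set $X$ of vertices of $\Delta_1$ the relative cochains $C^*(\Delta_1,X;V)$ form a dg ideal. Let $\mathrm{Ass}_\circ(\mathcal O)\in\mathbf{Op}$ be the operad generated by non-symmetric binary operations $\cup\otimes\mu$, depending linearly on $\mu\in\mathcal O(2)$ (thus, if $\mathcal O$ is generated by non-symmetric products $\cdot_i$, commutative products $\bullet_j$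 and anti-commutative brackets $[-,-]_k$, freely generated by $\prec_i=\cup\otimes\cdot_i$, $\succ_i=\cup\otimes\cdot_i^{op}$, $\circ_j=\cup\otimes\bullet_j$, $\ast_k=\cup\otimes[-,-]_k$), with the largest space of ternary relations which hold for the cup products on $C^*(\Delta_1;V)$ for every $\mathcal O$-algebra $V$; a morphism $f:\mathcal O\to\mathcal P$ induces $\cup\otimes\mu\mapsto\cup\otimes f(\mu)$. Let $\mathcal Ass$ be the operad of associative algebras, with generating product $\cup$, and let $\mathcal Ass\circ\mathcal O$ be the Manin white product: the quadratic operad with generators the $S_2$-module $\mathcal Ass(2)\otimes\mathcal O(2)$ and ternary relations the kernel of $\mathcal F(\mathcal Ass(2)\otimes\mathcal O(2))(3)\to\mathcal Ass(3)\otimes\mathcal O(3)$. **Theorem.** For every $\mathcal O\in\mathbf{Op}$ and every $\mathcal O$-algebra $V$ the cup products make $C^*(\Delta_1;V)$ a local dg $\mathrm{Ass}_\circ(\mathcal O)$-algebra, and there is a natural isomorphism $\mathrm{Ass}_\circ(-)\xrightarrow{\ \cong\ }\mathcal Ass\circ-$ of functors $\mathbf{Op}\to\mathbf{Op}$, which sends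 the generator $\cup\otimes\mu$ of $\mathrm{Ass}_\circ(\mathcal O)$ to the generator $\cup\otimes\mu$ of $\mathcal Ass\circ\mathcal O$, for all $\mu\in\mathcal O(2)$. -/

import Mathlib

universe u

open CategoryTheory
open scoped TensorProduct

noncomputable section

/-- The bijection of `{0, …, m}` that extends `e` and sends the last element to the last one. -/
def finExtend {m n : ℕ} (e : Fin m ≃ Fin n) : Fin (m + 1) ≃ Fin (n + 1) :=
  finSuccEquivLast.trans (e.optionCongr.trans finSuccEquivLast.symm)

/-- The block sum of two bijections. -/
def finBlock {m m' n n' : ℕ} (e : Fin m ≃ Fin m') (f : Fin n ≃ Fin n') :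
    Fin (m + n) ≃ Fin (m' + n') :=
  finSumFinEquiv.symm.trans ((e.sumCongr f).trans finSumFinEquiv)

/-- The permutation that exchanges the last two of three consecutive blocks, of sizes `l, m, n`. -/
def finExchange (l m n : ℕ) : Fin (l + m + n) ≃ Fin (l + n + m) :=
  (finCongr (Nat.add_assoc l m n)).trans
    ((finBlock (Equiv.refl (Fin l)) finAddFlip).trans (finCongr (Nat.add_assoc l n m).symm))

@[simp] theorem finExtend_castSucc {m n : ℕ} (e : Fin m ≃ Fin n) (i : Fin m) :
    finExtend e i.castSucc = (e i).castSucc := by simp [finExtend]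

@[simp] theorem finExtend_last {m n : ℕ} (e : Fin m ≃ Fin n) :
    finExtend e (Fin.last m) = Fin.last n := by simp [finExtend]

@[simp] theorem finBlock_castAdd {m m' n n' : ℕ} (e : Fin m ≃ Fin m') (f : Fin n ≃ Fin n')
    (i : Fin m) : finBlock e f (Fin.castAdd n i) = Fin.castAdd n' (e i) := by simp [finBlock]

@[simp] theorem finBlock_natAdd {m m' n n' : ℕ} (e : Fin m ≃ Fin m') (f : Fin n ≃ Fin n')
    (i : Fin n) : finBlock e f (Fin.natAdd m i) = Fin.natAdd m' (f i) := by simp [finBlock]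

@[simp] theorem finExchange_left (l m n : ℕ) (i : Fin l) :
    finExchange l m n (Fin.castAdd n (Fin.castAdd m i)) = Fin.castAdd m (Fin.castAdd n i) := by
  have : finCongr (Nat.add_assoc l m n) (Fin.castAdd n (Fin.castAdd m i)) =
      Fin.castAdd (m + n) i := by ext; simp
  simp only [finExchange, Equiv.trans_apply, this, finBlock_castAdd]
  ext; simp

@[simp] theorem finExchange_middle (l m n : ℕ) (i : Fin m) :
    finExchange l m n (Fin.castAdd n (Fin.natAdd l i)) = Fin.natAdd (l + n) i := by
  have : finCongr (Nat.add_assoc l m n) (Fin.castAdd n (Fin.natAdd l i)) =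
      Fin.natAdd l (Fin.castAdd n i) := by ext; simp
  simp only [finExchange, Equiv.trans_apply, this, finBlock_natAdd]
  ext; simp [Nat.add_assoc]

@[simp] theorem finExchange_right (l m n : ℕ) (i : Fin n) :
    finExchange l m n (Fin.natAdd (l + m) i) = Fin.castAdd m (Fin.natAdd l i) := by
  have : finCongr (Nat.add_assoc l m n) (Fin.natAdd (l + m) i) =
      Fin.natAdd l (Fin.natAdd m i) := by ext; simp [Nat.add_assoc]
  simp only [finExchange, Equiv.trans_apply, this, finBlock_natAdd]
  ext; simp

/-- A symmetric operad with unit in vector spaces over `K`.  `obj n` is the space of operations in the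
inputs `x₀, …, x_{n-1}`.  For a bijection `e` of inputs, `act e p` is `p` with its input `i` renamed
to `e i`, that is `(act e p)(x) = p(x_{e 0}, x_{e 1}, …)`; bijections `Fin m ≃ Fin n` (which exist
only for `m = n`) replace casts between equal arities.  `comp p q` is the partial composition in the
last input, `(comp p q)(x, y) = p(x, q(y))`; the partial compositions in the other inputs are
obtained from it by renaming inputs.  The axioms are those of partial compositions: equivariance,
unit, sequential associativity `(p ∘ q) ∘ r = p ∘ (q ∘ r)` and parallel commutativity
`p(x, q(y), r(z))`. -/
structure SymOperad (K : Type u) [Field K] where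
  obj : ℕ → Type u
  [addCommGroup : ∀ n, AddCommGroup (obj n)]
  [module : ∀ n, Module K (obj n)]
  act {m n : ℕ} (e : Fin m ≃ Fin n) : obj m →ₗ[K] obj n
  one : obj 1
  comp {m n : ℕ} : obj (m + 1) →ₗ[K] obj n →ₗ[K] obj (m + n)
  act_refl {n : ℕ} (p : obj n) : act (Equiv.refl (Fin n)) p = p
  act_trans {l m n : ℕ} (e : Fin l ≃ Fin m) (f : Fin m ≃ Fin n) (p : obj l) :
    act (e.trans f) p = act f (act e p)
  comp_act {m m' n n' : ℕ} (e : Fin m ≃ Fin m') (f : Fin n ≃ Fin n') (p : obj (m + 1))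
    (q : obj n) : comp (act (finExtend e) p) (act f q) = act (finBlock e f) (comp p q)
  comp_one {m : ℕ} (p : obj (m + 1)) : comp p one = p
  one_comp {n : ℕ} (q : obj n) : comp (m := 0) one q = act (finCongr (Nat.zero_add n).symm) q
  comp_assoc {l m n : ℕ} (p : obj (l + 1)) (q : obj (m + 1)) (r : obj n) :
    comp (m := l + m) (comp p q) r = act (finCongr (Nat.add_assoc l m n).symm) (comp p (comp q r))
  comp_comm {l m n : ℕ} (p : obj (l + 1 + 1)) (q : obj m) (r : obj n) :
    comp (act (finExchange l 1 n) (comp p r)) q =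
      act (finExchange l m n)
        (comp (act (finExchange l 1 m) (comp (act (finExchange l 1 1) p) q)) r)

namespace SymOperad

attribute [instance] SymOperad.addCommGroup SymOperad.module

variable {K : Type u} [Field K]

/-- Morphisms of operads. -/
@[ext]
structure Hom (P Q : SymOperad K) where
  app (n : ℕ) : P.obj n →ₗ[K] Q.obj n
  map_act {m n : ℕ} (e : Fin m ≃ Fin n) (p : P.obj m) : app n (P.act e p) = Q.act e (app m p)
  map_one : app 1 P.one = Q.one
  map_comp {m n : ℕ} (p : P.obj (m + 1)) (q : P.obj n) :
    app (m + n) (P.comp p q) = Q.comp (app (m + 1) p) (app n q)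

instance : Category (SymOperad K) where
  Hom := Hom
  id P := ⟨fun _ => LinearMap.id, fun _ _ => rfl, rfl, fun _ _ => rfl⟩
  comp f g := ⟨fun n => (g.app n).comp (f.app n), fun e p => by simp [f.map_act, g.map_act],
    by simp [f.map_one, g.map_one], fun p q => by simp [f.map_comp, g.map_comp]⟩

theorem hom_ext_app {P Q : SymOperad K} {f g : P ⟶ Q} (h : ∀ n p, f.app n p = g.app n p) : f = g :=
  Hom.ext (funext fun n => LinearMap.ext (h n))

section Update
variable {V : Type u} {m n : ℕ} (v : Fin (m + n) → V) (w : V)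

theorem update_left (i : Fin m) :
    (fun j => Function.update v (Fin.castAdd n i) w (Fin.castAdd n j)) =
      Function.update (fun j => v (Fin.castAdd n j)) i w :=
  Function.update_comp_eq_of_injective v (Fin.castAdd_injective m n) i w

theorem update_right (i : Fin n) :
    (fun j => Function.update v (Fin.natAdd m i) w (Fin.natAdd m j)) =
      Function.update (fun j => v (Fin.natAdd m j)) i w :=
  Function.update_comp_eq_of_injective v (Fin.natAdd_injective n m) i w

theorem update_left_right (i : Fin m) :
    (fun j : Fin n => Function.update v (Fin.castAdd n i) w (Fin.natAdd m j)) =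
      fun j => v (Fin.natAdd m j) :=
  Function.update_comp_eq_of_forall_ne v w fun j => by simp [Fin.ext_iff]; omega

theorem update_right_left (i : Fin n) :
    (fun j : Fin m => Function.update v (Fin.natAdd m i) w (Fin.castAdd n j)) =
      fun j => v (Fin.castAdd n j) :=
  Function.update_comp_eq_of_forall_ne v w fun j => by simp [Fin.ext_iff]; omega

end Update

section EndOperad
variable {V : Type u} [AddCommGroup V] [Module K V]

/-- `(f, g) ↦ ((v, w) ↦ f(v, g(w)))` -/
def insertLast {m n : ℕ} (f : MultilinearMap K (fun _ : Fin (m + 1) => V) V)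
    (g : MultilinearMap K (fun _ : Fin n => V) V) :
    MultilinearMap K (fun _ : Fin (m + n) => V) V :=
  MultilinearMap.mk' (fun v => f (Fin.snoc (α := fun _ => V) (fun i => v (Fin.castAdd n i))
      (g fun j => v (Fin.natAdd m j))))
    (fun v i x y => by
      induction i using Fin.addCases with
      | left i => simp only [update_left, update_left_right, Fin.snoc_update,
          MultilinearMap.map_update_add]
      | right i => simp only [update_right, update_right_left, MultilinearMap.map_update_add,
          MultilinearMap.snoc_add])
    (fun v i c x => by
      induction i using Fin.addCases with
      | left i => simp only [update_left, update_left_right, Fin.snoc_update,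
          MultilinearMap.map_update_smul]
      | right i => simp only [update_right, update_right_left, MultilinearMap.map_update_smul,
          MultilinearMap.snoc_smul])

@[simp] theorem insertLast_apply {m n : ℕ} (f : MultilinearMap K (fun _ : Fin (m + 1) => V) V)
    (g : MultilinearMap K (fun _ : Fin n => V) V) (v : Fin (m + n) → V) :
    insertLast f g v = f (Fin.snoc (α := fun _ => V) (fun i => v (Fin.castAdd n i))
      (g fun j => v (Fin.natAdd m j))) := rfl

variable (V) in
/-- The endomorphism operad of `V`. A structure of algebra over `P` on `V` is a morphism
`P ⟶ endOperad V`. -/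
def endOperad : SymOperad K where
  obj n := MultilinearMap K (fun _ : Fin n => V) V
  act e := (MultilinearMap.domDomCongrLinearEquiv K K V V e).toLinearMap
  one := MultilinearMap.ofSubsingleton K V V (0 : Fin 1) LinearMap.id
  comp := LinearMap.mk₂ K insertLast (fun _ _ _ => by ext; simp) (fun _ _ _ => by ext; simp)
    (fun f g h => by ext v; simp [MultilinearMap.snoc_add])
    (fun c f g => by ext v; simp [MultilinearMap.snoc_smul])
  act_refl _ := rfl
  act_trans _ _ _ := rfl
  comp_act e f p q := by
    ext v
    change p _ = p _
    congr 1
    ext i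
    induction i using Fin.lastCases with
    | last =>
      change Fin.snoc (α := fun _ => V) _ _ (finExtend e _) = _
      rw [finExtend_last, Fin.snoc_last, Fin.snoc_last]
      exact congrArg q (funext fun j => congrArg v (finBlock_natAdd e f j).symm)
    | cast i =>
      change Fin.snoc (α := fun _ => V) _ _ (finExtend e _) = _
      rw [finExtend_castSucc, Fin.snoc_castSucc, Fin.snoc_castSucc]
      exact congrArg v (finBlock_castAdd e f i).symm
  comp_one p := by
    ext v
    change p _ = p _
    congr 1
    ext i
    induction i using Fin.lastCases with
    | last => rw [Fin.snoc_last]; rfl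
    | cast i => rw [Fin.snoc_castSucc]; rfl
  one_comp q := by
    ext v
    change q _ = q _
    congr 1
    ext i
    exact congrArg v (by ext; simp)
  comp_assoc {l m n} p q r := by
    ext v
    change p _ = p _
    congr 1
    ext i
    induction i using Fin.lastCases with
    | cast i =>
      rw [Fin.snoc_castSucc, Fin.snoc_castSucc]
      exact (Fin.snoc_castSucc (α := fun _ => V) _ _ (Fin.castAdd m i)).trans
        (congrArg v (by ext; simp))
    | last =>
      rw [Fin.snoc_last, Fin.snoc_last]
      change q _ = q _
      congr 1
      ext j
      induction j using Fin.lastCases with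
      | cast j =>
        rw [Fin.snoc_castSucc]
        exact (Fin.snoc_castSucc (α := fun _ => V) _ _ (Fin.natAdd l j)).trans
          (congrArg v (by ext; simp))
      | last =>
        rw [Fin.snoc_last]
        exact (Fin.snoc_last (α := fun _ => V) _ _).trans
          (congrArg r (funext fun k => congrArg v (by ext; simp [Nat.add_assoc])))
  comp_comm {l m n} p q r := by
    have last_eq : ∀ k, Fin.last k = Fin.natAdd k (0 : Fin 1) := fun k => by ext; simp
    have cast_eq : ∀ {k} (i : Fin k), i.castSucc = Fin.castAdd 1 i := fun i => rfl
    have el : ∀ {k} (f : Fin k → V) (x : V) , Fin.snoc (α := fun _ => V) f x (Fin.natAdd k (0 : Fin 1)) = x :=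
      fun f x => Fin.snoc_last (α := fun _ => V) _ _
    have ec : ∀ {k} (f : Fin k → V) (x : V) (i : Fin k), Fin.snoc (α := fun _ => V) f x (Fin.castAdd 1 i) = f i :=
      fun f x i => Fin.snoc_castSucc (α := fun _ => V) _ _ _
    ext v
    change p _ = p _
    congr 1
    ext i
    beta_reduce
    simp only [finExchange_right, ec]
    induction i using Fin.lastCases with
    | last =>
      rw [last_eq, el, finExchange_right, ec, finExchange_middle, el]
      exact congrArg r (funext fun j => congrArg v (finExchange_right l m n j).symm)
    | cast i =>
      rw [cast_eq, ec]
      induction i using Fin.lastCases with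
      | last =>
        rw [last_eq, finExchange_middle, finExchange_middle, el, el]
        exact congrArg q (funext fun j => congrArg v (finExchange_middle l m n j).symm)
      | cast i =>
        rw [cast_eq, finExchange_left, finExchange_left, ec, ec, finExchange_left, ec, finExchange_left]
end EndOperad

/-- The Hadamard (arity-wise) tensor product of two operads. -/
def hadamard (P Q : SymOperad K) : SymOperad K where
  obj n := P.obj n ⊗[K] Q.obj n
  act e := TensorProduct.map (P.act e) (Q.act e)
  one := P.one ⊗ₜ Q.one
  comp := TensorProduct.map₂ P.comp Q.comp
  act_refl p := by
    induction p using TensorProduct.induction_on with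
    | zero => simp
    | tmul a b => simp [act_refl]
    | add a b ha hb => simp [ha, hb]
  act_trans e f p := by
    induction p using TensorProduct.induction_on with
    | zero => simp
    | tmul a b => simp [act_trans]
    | add a b ha hb => simp [ha, hb]
  comp_act e f p q := by
    induction p using TensorProduct.induction_on with
    | zero => simp
    | add a b ha hb => simp [ha, hb]
    | tmul a b =>
      induction q using TensorProduct.induction_on with
      | zero => simp
      | add a b ha hb => simp only [map_add, ha, hb]
      | tmul c d => simp [comp_act]
  comp_one p := by
    induction p using TensorProduct.induction_on with
    | zero => simp
    | tmul a b => simp [comp_one]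
    | add a b ha hb => simp [ha, hb]
  one_comp p := by
    induction p using TensorProduct.induction_on with
    | zero => simp
    | tmul a b => simp [one_comp]
    | add a b ha hb => simp only [map_add, ha, hb]
  comp_assoc p q r := by
    induction p using TensorProduct.induction_on with
    | zero => simp
    | add a b ha hb => simp only [map_add, LinearMap.add_apply, ha, hb]
    | tmul a b =>
      induction q using TensorProduct.induction_on with
      | zero => simp
      | add a b ha hb => simp only [map_add, LinearMap.add_apply, ha, hb]
      | tmul c d =>
        induction r using TensorProduct.induction_on with
        | zero => simp
        | add a b ha hb => simp only [map_add, ha, hb]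
        | tmul c d => simp [comp_assoc]
  comp_comm p q r := by
    induction p using TensorProduct.induction_on with
    | zero => simp
    | add a b ha hb => simp only [map_add, LinearMap.add_apply, ha, hb]
    | tmul a b =>
      induction q using TensorProduct.induction_on with
      | zero => simp
      | add a b ha hb => simp only [map_add, LinearMap.add_apply, ha, hb]
      | tmul c d =>
        induction r using TensorProduct.induction_on with
        | zero => simp
        | add a b ha hb => simp only [map_add, LinearMap.add_apply, ha, hb]
        | tmul c d =>
          simp only [TensorProduct.map₂_apply_tmul, TensorProduct.map_tmul]
          rw [P.comp_comm, Q.comp_comm]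


/-! ### Free operads on binary generators -/
section Free
variable {E : Type u} [AddCommGroup E] [Module K E] (τ : E →ₗ[K] E)

variable (K E) in
/-- Formal expressions in generators `x ∈ E` of arity two and the structure operations of an operad. -/
inductive OpTerm : ℕ → Type u
  | zero (n : ℕ) : OpTerm n
  | add {n : ℕ} (p q : OpTerm n) : OpTerm n
  | smul {n : ℕ} (c : K) (p : OpTerm n) : OpTerm n
  | gen (x : E) : OpTerm 2
  | act {m n : ℕ} (e : Fin m ≃ Fin n) (p : OpTerm m) : OpTerm n
  | one : OpTerm 1
  | comp {m n : ℕ} (p : OpTerm (m + 1)) (q : OpTerm n) : OpTerm (m + n)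

open SymOperad.OpTerm in
/-- The relations defining the free operad on `E`, where `τ : E → E` is the action of the
transposition. -/
inductive OpTerm.Rel : ∀ {n : ℕ}, OpTerm K E n → OpTerm K E n → Prop
  -- congruences
  | add_left {n : ℕ} {p p' : OpTerm K E n} (q : OpTerm K E n) (h : Rel p p') :
      Rel (add p q) (add p' q)
  | add_right {n : ℕ} (p : OpTerm K E n) {q q' : OpTerm K E n} (h : Rel q q') :
      Rel (add p q) (add p q')
  | smul_congr {n : ℕ} (c : K) {p p' : OpTerm K E n} (h : Rel p p') : Rel (smul c p) (smul c p')
  | act_congr {m n : ℕ} (e : Fin m ≃ Fin n) {p p' : OpTerm K E m} (h : Rel p p') :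
      Rel (act e p) (act e p')
  | comp_left {m n : ℕ} {p p' : OpTerm K E (m + 1)} (q : OpTerm K E n) (h : Rel p p') :
      Rel (comp p q) (comp p' q)
  | comp_right {m n : ℕ} (p : OpTerm K E (m + 1)) {q q' : OpTerm K E n} (h : Rel q q') :
      Rel (comp p q) (comp p q')
  -- each arity is a vector space
  | add_comm {n : ℕ} (p q : OpTerm K E n) : Rel (add p q) (add q p)
  | add_assoc {n : ℕ} (p q r : OpTerm K E n) : Rel (add (add p q) r) (add p (add q r))
  | zero_add {n : ℕ} (p : OpTerm K E n) : Rel (add (zero n) p) p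
  | smul_add {n : ℕ} (c : K) (p q : OpTerm K E n) :
      Rel (smul c (add p q)) (add (smul c p) (smul c q))
  | add_smul {n : ℕ} (c d : K) (p : OpTerm K E n) :
      Rel (smul (c + d) p) (add (smul c p) (smul d p))
  | mul_smul {n : ℕ} (c d : K) (p : OpTerm K E n) : Rel (smul (c * d) p) (smul c (smul d p))
  | one_smul {n : ℕ} (p : OpTerm K E n) : Rel (smul 1 p) p
  | zero_smul {n : ℕ} (p : OpTerm K E n) : Rel (smul 0 p) (zero n)
  -- relabelling and composition are linear
  | act_add {m n : ℕ} (e : Fin m ≃ Fin n) (p q : OpTerm K E m) :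
      Rel (act e (add p q)) (add (act e p) (act e q))
  | act_smul {m n : ℕ} (e : Fin m ≃ Fin n) (c : K) (p : OpTerm K E m) :
      Rel (act e (smul c p)) (smul c (act e p))
  | add_comp {m n : ℕ} (p p' : OpTerm K E (m + 1)) (q : OpTerm K E n) :
      Rel (comp (add p p') q) (add (comp p q) (comp p' q))
  | smul_comp {m n : ℕ} (c : K) (p : OpTerm K E (m + 1)) (q : OpTerm K E n) :
      Rel (comp (smul c p) q) (smul c (comp p q))
  | comp_add {m n : ℕ} (p : OpTerm K E (m + 1)) (q q' : OpTerm K E n) :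
      Rel (comp p (add q q')) (add (comp p q) (comp p q'))
  | comp_smul {m n : ℕ} (c : K) (p : OpTerm K E (m + 1)) (q : OpTerm K E n) :
      Rel (comp p (smul c q)) (smul c (comp p q))
  -- the operad axioms
  | act_refl {n : ℕ} (p : OpTerm K E n) : Rel (act (Equiv.refl (Fin n)) p) p
  | act_trans {l m n : ℕ} (e : Fin l ≃ Fin m) (f : Fin m ≃ Fin n) (p : OpTerm K E l) :
      Rel (act (e.trans f) p) (act f (act e p))
  | comp_act {m m' n n' : ℕ} (e : Fin m ≃ Fin m') (f : Fin n ≃ Fin n') (p : OpTerm K E (m + 1))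
      (q : OpTerm K E n) :
      Rel (comp (act (finExtend e) p) (act f q)) (act (finBlock e f) (comp p q))
  | comp_one {m : ℕ} (p : OpTerm K E (m + 1)) : Rel (comp p one) p
  | one_comp {n : ℕ} (q : OpTerm K E n) :
      Rel (comp (m := 0) one q) (act (finCongr (Nat.zero_add n).symm) q)
  | comp_assoc {l m n : ℕ} (p : OpTerm K E (l + 1)) (q : OpTerm K E (m + 1)) (r : OpTerm K E n) :
      Rel (comp (m := l + m) (OpTerm.comp (n := m + 1) p q) r)
        (act (finCongr (Nat.add_assoc l m n).symm) (comp p (comp q r)))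
  | comp_comm {l m n : ℕ} (p : OpTerm K E (l + 1 + 1)) (q : OpTerm K E m) (r : OpTerm K E n) :
      Rel (comp (act (finExchange l 1 n) (comp p r)) q)
        (act (finExchange l m n)
          (comp (act (finExchange l 1 m) (comp (act (finExchange l 1 1) p) q)) r))
  -- the generators form a module over the symmetric group on two letters
  | gen_add (x y : E) : Rel (gen (x + y)) (add (gen x) (gen y))
  | gen_smul (c : K) (x : E) : Rel (gen (c • x)) (smul c (gen x))
  | gen_swap (x : E) : Rel (act (Equiv.swap 0 1) (gen x)) (gen (τ x))

/-- The arity `n` component of the free operad. -/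
def FreeObj (n : ℕ) : Type u := Quot (OpTerm.Rel τ (n := n))

namespace FreeObj
variable {τ} {n : ℕ}

/-- The class of an expression. -/
def mk (p : OpTerm K E n) : FreeObj τ n := Quot.mk _ p

instance : Add (FreeObj τ n) where
  add := Quot.map₂ OpTerm.add (fun p _ _ h => OpTerm.Rel.add_right p h)
    (fun _ _ q h => OpTerm.Rel.add_left q h)

instance : SMul K (FreeObj τ n) where
  smul c := Quot.map (OpTerm.smul c) fun _ _ h => OpTerm.Rel.smul_congr c h

instance : Zero (FreeObj τ n) := ⟨mk (.zero n)⟩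

theorem mk_zero_add (p : FreeObj τ n) : 0 + p = p := by
  rcases p with ⟨p⟩; exact Quot.sound (.zero_add p)

theorem mk_add_comm (p q : FreeObj τ n) : p + q = q + p := by
  rcases p with ⟨p⟩; rcases q with ⟨q⟩; exact Quot.sound (.add_comm p q)

theorem mk_zero_smul (p : FreeObj τ n) : (0 : K) • p = 0 := by
  rcases p with ⟨p⟩; exact Quot.sound (.zero_smul p)

theorem mk_mul_smul (c d : K) (p : FreeObj τ n) : (c * d) • p = c • d • p := by
  rcases p with ⟨p⟩; exact Quot.sound (.mul_smul c d p)

instance : AddCommMonoid (FreeObj τ n) where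
  add_assoc := by
    rintro ⟨p⟩ ⟨q⟩ ⟨r⟩; exact Quot.sound (.add_assoc p q r)
  zero_add := mk_zero_add
  add_zero p := by rw [mk_add_comm, mk_zero_add]
  add_comm := mk_add_comm
  nsmul := nsmulRec

instance : Module K (FreeObj τ n) where
  one_smul := by rintro ⟨p⟩; exact Quot.sound (.one_smul p)
  mul_smul := mk_mul_smul
  smul_zero c := by rw [← mk_zero_smul (0 : FreeObj τ n), ← mk_mul_smul, mul_zero]
  smul_add c := by rintro ⟨p⟩ ⟨q⟩; exact Quot.sound (.smul_add c p q)
  add_smul c d := by rintro ⟨p⟩; exact Quot.sound (.add_smul c d p)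
  zero_smul := mk_zero_smul

instance : AddCommGroup (FreeObj τ n) := Module.addCommMonoidToAddCommGroup K

end FreeObj

/-- The free symmetric operad on a module `E` over the symmetric group on two letters, placed in
arity two; the transposition acts by `τ`. See `free.lift` and `free.hom_ext` for its universal
property. -/
def free : SymOperad K where
  obj := FreeObj τ
  act e :=
    { toFun := Quot.map (OpTerm.act e) fun _ _ h => .act_congr e h
      map_add' := by rintro ⟨p⟩ ⟨q⟩; exact Quot.sound (.act_add e p q)
      map_smul' := by rintro c ⟨p⟩; exact Quot.sound (.act_smul e c p) }
  one := FreeObj.mk .one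
  comp := LinearMap.mk₂ K
    (Quot.map₂ OpTerm.comp (fun p _ _ h => .comp_right p h) (fun _ _ q h => .comp_left q h))
    (by rintro ⟨p⟩ ⟨p'⟩ ⟨q⟩; exact Quot.sound (.add_comp p p' q))
    (by rintro c ⟨p⟩ ⟨q⟩; exact Quot.sound (.smul_comp c p q))
    (by rintro ⟨p⟩ ⟨q⟩ ⟨q'⟩; exact Quot.sound (.comp_add p q q'))
    (by rintro c ⟨p⟩ ⟨q⟩; exact Quot.sound (.comp_smul c p q))
  act_refl := by rintro _ ⟨p⟩; exact Quot.sound (.act_refl p)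
  act_trans := by rintro _ _ _ e f ⟨p⟩; exact Quot.sound (.act_trans e f p)
  comp_act := by rintro _ _ _ _ e f ⟨p⟩ ⟨q⟩; exact Quot.sound (.comp_act e f p q)
  comp_one := by rintro _ ⟨p⟩; exact Quot.sound (.comp_one p)
  one_comp := by rintro _ ⟨q⟩; exact Quot.sound (.one_comp q)
  comp_assoc := by rintro _ _ _ ⟨p⟩ ⟨q⟩ ⟨r⟩; exact Quot.sound (.comp_assoc p q r)
  comp_comm := by rintro _ _ _ ⟨p⟩ ⟨q⟩ ⟨r⟩; exact Quot.sound (.comp_comm p q r)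

namespace free

/-- The generators. -/
def gen : E →ₗ[K] (free τ).obj 2 where
  toFun x := FreeObj.mk (.gen x)
  map_add' x y := Quot.sound (.gen_add x y)
  map_smul' c x := Quot.sound (.gen_smul c x)

theorem act_swap_gen (x : E) :
    (free τ).act (Equiv.swap 0 1) (gen τ x) = gen τ (τ x) := Quot.sound (.gen_swap x)

variable {τ}

/-- Evaluation of a formal expression in an operad. -/
def eval {P : SymOperad K} (φ : E →ₗ[K] P.obj 2) : ∀ {n : ℕ}, OpTerm K E n → P.obj n
  | _, .zero _ => 0
  | _, .add p q => eval φ p + eval φ q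
  | _, .smul c p => c • eval φ p
  | _, .gen x => φ x
  | _, .act e p => P.act e (eval φ p)
  | _, .one => P.one
  | _, .comp p q => P.comp (eval φ p) (eval φ q)

theorem eval_rel {P : SymOperad K} (φ : E →ₗ[K] P.obj 2)
    (hφ : ∀ x, φ (τ x) = P.act (Equiv.swap 0 1) (φ x)) {n : ℕ} {p q : OpTerm K E n}
    (h : OpTerm.Rel τ p q) : eval φ p = eval φ q := by
  induction h with
  | comp_act => exact P.comp_act ..
  | act_trans => exact P.act_trans ..
  | act_refl => exact P.act_refl ..
  | comp_one => exact P.comp_one ..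
  | one_comp => exact P.one_comp ..
  | comp_assoc => exact P.comp_assoc ..
  | comp_comm => exact P.comp_comm ..
  | add_comm => exact add_comm ..
  | add_assoc => exact add_assoc ..
  | mul_smul => exact mul_smul ..
  | add_smul => exact add_smul ..
  | gen_swap => simp [eval, hφ]
  | _ => simp_all [eval]

/-- The morphism from the free operad that extends an equivariant map on generators. -/
def lift {P : SymOperad K} (φ : E →ₗ[K] P.obj 2)
    (hφ : ∀ x, φ (τ x) = P.act (Equiv.swap 0 1) (φ x)) : free τ ⟶ P where
  app n :=
    { toFun := Quot.lift (eval φ) fun _ _ h => eval_rel φ hφ h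
      map_add' := by rintro ⟨p⟩ ⟨q⟩; rfl
      map_smul' := by rintro c ⟨p⟩; rfl }
  map_act := by rintro _ _ e ⟨p⟩; rfl
  map_one := rfl
  map_comp := by rintro _ _ ⟨p⟩ ⟨q⟩; rfl

theorem lift_gen {P : SymOperad K} (φ : E →ₗ[K] P.obj 2)
    (hφ : ∀ x, φ (τ x) = P.act (Equiv.swap 0 1) (φ x)) (x : E) :
    (lift φ hφ).app 2 (gen τ x) = φ x := rfl

theorem hom_ext {P : SymOperad K} {f g : free τ ⟶ P}
    (h : ∀ x, f.app 2 (gen τ x) = g.app 2 (gen τ x)) : f = g := by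
  suffices key : ∀ {n : ℕ} (p : OpTerm K E n),
      f.app n (FreeObj.mk p) = g.app n (FreeObj.mk p) from
    hom_ext_app fun n => Quot.ind fun p => key p
  intro n p
  induction p with
  | zero => exact (map_zero _).trans (map_zero _).symm
  | add p q hp hq =>
    exact (map_add _ (FreeObj.mk p) (FreeObj.mk q)).trans
      ((congrArg₂ _ hp hq).trans (map_add _ (FreeObj.mk p) (FreeObj.mk q)).symm)
  | smul c p hp =>
    exact (map_smul _ c (FreeObj.mk p)).trans
      ((congrArg _ hp).trans (map_smul _ c (FreeObj.mk p)).symm)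
  | gen x => exact h x
  | act e p hp => exact (f.map_act e _).trans ((congrArg _ hp).trans (g.map_act e _).symm)
  | one => exact f.map_one.trans g.map_one.symm
  | comp p q hp hq =>
    exact (f.map_comp (FreeObj.mk p) (FreeObj.mk q)).trans
      ((congrArg₂ (fun a b => P.comp a b) hp hq).trans
        (g.map_comp (FreeObj.mk p) (FreeObj.mk q)).symm)

end free
end Free

/-! ### Ideals and quotients -/

/-- Operadic ideals. (Ideals are stable under composition in the last input and renaming, hence under
all partial compositions.) -/
structure IsIdeal (P : SymOperad K) (I : ∀ n, Submodule K (P.obj n)) : Prop where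
  act_mem {m n : ℕ} (e : Fin m ≃ Fin n) {p : P.obj m} (hp : p ∈ I m) : P.act e p ∈ I n
  comp_left {m n : ℕ} {p : P.obj (m + 1)} (hp : p ∈ I (m + 1)) (q : P.obj n) :
    P.comp p q ∈ I (m + n)
  comp_right {m n : ℕ} (p : P.obj (m + 1)) {q : P.obj n} (hq : q ∈ I n) :
    P.comp p q ∈ I (m + n)

/-- The operadic ideal generated by a set of ternary operations. -/
def ideal (P : SymOperad K) (S : Set (P.obj 3)) (n : ℕ) : Submodule K (P.obj n) :=
  ⨅ I : {I : ∀ n, Submodule K (P.obj n) // P.IsIdeal I ∧ S ⊆ I 3}, I.1 n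

theorem mem_ideal {P : SymOperad K} {S : Set (P.obj 3)} {n : ℕ} {p : P.obj n} :
    p ∈ P.ideal S n ↔ ∀ I, P.IsIdeal I → S ⊆ I 3 → p ∈ I n := by
  simp [ideal]

theorem isIdeal_ideal (P : SymOperad K) (S : Set (P.obj 3)) : P.IsIdeal (P.ideal S) where
  act_mem e _ hp := mem_ideal.2 fun I hI hS => hI.act_mem e (mem_ideal.1 hp I hI hS)
  comp_left hp q := mem_ideal.2 fun I hI hS => hI.comp_left (mem_ideal.1 hp I hI hS) q
  comp_right p _ hq := mem_ideal.2 fun I hI hS => hI.comp_right p (mem_ideal.1 hq I hI hS)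

theorem subset_ideal (P : SymOperad K) (S : Set (P.obj 3)) : S ⊆ P.ideal S 3 :=
  fun _ hp => mem_ideal.2 fun _ _ hS => hS hp

/-- The quotient of an operad by the ideal generated by a set of ternary operations. -/
def quotient (P : SymOperad K) (S : Set (P.obj 3)) : SymOperad K where
  obj n := P.obj n ⧸ P.ideal S n
  act {m n} e := Submodule.mapQ _ _ (P.act e) fun _ hp => (P.isIdeal_ideal S).act_mem e hp
  one := Submodule.Quotient.mk P.one
  comp {m n} := Submodule.liftQ _
    { toFun := fun p => Submodule.mapQ _ _ (P.comp p) fun _ hq =>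
        (P.isIdeal_ideal S).comp_right p hq
      map_add' := fun p p' => Submodule.linearMap_qext _ (LinearMap.ext fun q => by simp)
      map_smul' := fun c p => Submodule.linearMap_qext _ (LinearMap.ext fun q => by simp) }
    fun p hp => Submodule.linearMap_qext _ (LinearMap.ext fun q =>
      (Submodule.Quotient.mk_eq_zero _).2 ((P.isIdeal_ideal S).comp_left hp q))
  act_refl := by rintro n ⟨p⟩; exact congrArg Submodule.Quotient.mk (P.act_refl p)
  act_trans := by rintro _ _ _ e f ⟨p⟩; exact congrArg Submodule.Quotient.mk (P.act_trans e f p)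
  comp_act := by
    rintro _ _ _ _ e f ⟨p⟩ ⟨q⟩; exact congrArg Submodule.Quotient.mk (P.comp_act e f p q)
  comp_one := by rintro _ ⟨p⟩; exact congrArg Submodule.Quotient.mk (P.comp_one p)
  one_comp := by rintro _ ⟨p⟩; exact congrArg Submodule.Quotient.mk (P.one_comp p)
  comp_assoc := by
    rintro _ _ _ ⟨p⟩ ⟨q⟩ ⟨r⟩; exact congrArg Submodule.Quotient.mk (P.comp_assoc p q r)
  comp_comm := by
    rintro _ _ _ ⟨p⟩ ⟨q⟩ ⟨r⟩; exact congrArg Submodule.Quotient.mk (P.comp_comm p q r)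

namespace quotient
variable {P : SymOperad K} (S : Set (P.obj 3))

/-- The projection onto the quotient. -/
def proj : P ⟶ P.quotient S where
  app n := (P.ideal S n).mkQ
  map_act _ _ := rfl
  map_one := rfl
  map_comp _ _ := rfl

theorem hom_ext {Q : SymOperad K} {f g : P.quotient S ⟶ Q}
    (h : proj S ≫ f = proj S ≫ g) : f = g := by
  refine hom_ext_app fun n => ?_
  rintro ⟨p⟩
  exact LinearMap.congr_fun (congrFun (congrArg Hom.app h) n) p

variable {S}

theorem isIdeal_ker {Q : SymOperad K} (f : P ⟶ Q) :
    P.IsIdeal fun n => LinearMap.ker (f.app n) where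
  act_mem e p hp := by
    rw [LinearMap.mem_ker] at hp ⊢
    rw [f.map_act, hp, map_zero]
  comp_left hp q := by
    rw [LinearMap.mem_ker] at hp ⊢
    rw [f.map_comp, hp, map_zero, LinearMap.zero_apply]
  comp_right p q hq := by
    rw [LinearMap.mem_ker] at hq ⊢
    rw [f.map_comp, hq, map_zero]

/-- Morphisms out of the quotient. -/
def lift {Q : SymOperad K} (f : P ⟶ Q) (hf : ∀ p ∈ S, f.app 3 p = 0) : P.quotient S ⟶ Q where
  app n := Submodule.liftQ _ (f.app n) fun _ hp => mem_ideal.1 hp _ (isIdeal_ker f) hf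
  map_act := by rintro _ _ e ⟨p⟩; exact f.map_act e p
  map_one := f.map_one
  map_comp := by rintro _ _ ⟨p⟩ ⟨q⟩; exact f.map_comp p q

theorem proj_lift {Q : SymOperad K} (f : P ⟶ Q) (hf : ∀ p ∈ S, f.app 3 p = 0) :
    proj S ≫ lift f hf = f := rfl

end quotient


/-! ### quadratic operads -/

/-- The action of the transposition on binary operations, `μ ↦ μ^op`. -/
def swap (P : SymOperad K) : P.obj 2 →ₗ[K] P.obj 2 := P.act (Equiv.swap 0 1)

theorem swap_swap (P : SymOperad K) (p : P.obj 2) : P.swap (P.swap p) = p := by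
  rw [swap, ← P.act_trans]
  have : (Equiv.swap (0 : Fin 2) 1).trans (Equiv.swap 0 1) = Equiv.refl _ := by ext; simp
  rw [this, P.act_refl]

section Quadratic

variable {E : Type u} [AddCommGroup E] [Module K E]

/-- The binary quadratic operad with generators `E` (transposition acting by `τ`) and ternary relations
`R`. -/
def quadratic (τ : E →ₗ[K] E) (R : Submodule K ((free τ).obj 3)) : SymOperad K :=
  (free τ).quotient (R : Set ((free τ).obj 3))

variable {F : Type u} [AddCommGroup F] [Module K F]

/-- Functoriality of the free operad. -/
def freeMap {σ : E →ₗ[K] E} {τ : F →ₗ[K] F} (φ : E →ₗ[K] F) (hφ : ∀ x, φ (σ x) = τ (φ x)) :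
    free σ ⟶ free τ :=
  free.lift ((free.gen τ).comp φ) fun x => by
    simp only [LinearMap.comp_apply, hφ, free.act_swap_gen]

/-- The morphism of quadratic operads induced by an equivariant map of generators that respects the
relations. -/
def quadraticMap {σ : E →ₗ[K] E} {τ : F →ₗ[K] F} {R : Submodule K ((free σ).obj 3)}
    {S : Submodule K ((free τ).obj 3)} (φ : E →ₗ[K] F) (hφ : ∀ x, φ (σ x) = τ (φ x))
    (h : ∀ r ∈ R, (freeMap φ hφ).app 3 r ∈ S) : quadratic σ R ⟶ quadratic τ S :=
  quotient.lift (freeMap φ hφ ≫ quotient.proj _) fun r hr =>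
    (Submodule.Quotient.mk_eq_zero _).2 (subset_ideal _ _ (h r hr))

/-- The generators of a quadratic operad. -/
def quadratic.gen (τ : E →ₗ[K] E) (R : Submodule K ((free τ).obj 3)) :
    E →ₗ[K] (quadratic τ R).obj 2 :=
  ((quotient.proj (P := free τ) R).app 2).comp (free.gen τ)

theorem quadratic.hom_ext {τ : E →ₗ[K] E} {R : Submodule K ((free τ).obj 3)} {P : SymOperad K}
    {f g : quadratic τ R ⟶ P}
    (h : ∀ x, f.app 2 (quadratic.gen τ R x) = g.app 2 (quadratic.gen τ R x)) : f = g :=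
  quotient.hom_ext _ (free.hom_ext h)

theorem quadraticMap_gen {σ : E →ₗ[K] E} {τ : F →ₗ[K] F} {R : Submodule K ((free σ).obj 3)}
    {S : Submodule K ((free τ).obj 3)} (φ : E →ₗ[K] F) (hφ : ∀ x, φ (σ x) = τ (φ x))
    (h : ∀ r ∈ R, (freeMap φ hφ).app 3 r ∈ S) (x : E) :
    (quadraticMap φ hφ h).app 2 (quadratic.gen σ R x) = quadratic.gen τ S (φ x) := rfl

end Quadratic

/-- Finitely generated binary quadratic operads: those presented by a finite dimensional module of
binary generators over the symmetric group on two letters (over any field such a module is a sum of regular, trivial and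
sign modules, that is, of non-symmetric, commutative and anti-commutative products) and ternary
relations. -/
def IsBinaryQuadratic (P : SymOperad K) : Prop :=
  ∃ (E : Type u) (_ : AddCommGroup E) (_ : Module K E) (_ : FiniteDimensional K E)
    (τ : E →ₗ[K] E) (_ : Function.Involutive τ) (R : Submodule K ((free τ).obj 3)),
    Nonempty (P ≅ quadratic τ R)

section Finite
variable {E : Type u} [AddCommGroup E] [Module K E] (τ : E →ₗ[K] E)

/-- Explicit description of the free operad in arities at most two. -/
def lowSpan : ∀ n : ℕ, Submodule K ((free τ).obj n)
  | 0 => ⊥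
  | 1 => K ∙ (free τ).one
  | 2 => LinearMap.range (free.gen τ)
  | _ + 3 => ⊤

theorem lowSpan_act {n : ℕ} (e : Fin n ≃ Fin n) {p : (free τ).obj n} (hp : p ∈ lowSpan τ n) :
    (free τ).act e p ∈ lowSpan τ n := by
  match n with
  | 0 =>
    obtain rfl : p = 0 := hp
    exact (map_zero ((free τ).act e)).symm ▸ Submodule.zero_mem _
  | 1 =>
    rw [Subsingleton.elim e (Equiv.refl _), (free τ).act_refl]; exact hp
  | 2 =>
    obtain ⟨x, rfl⟩ := hp
    have : e = Equiv.refl _ ∨ e = Equiv.swap 0 1 := by revert e; decide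
    rcases this with rfl | rfl
    · rw [(free τ).act_refl]; exact ⟨x, rfl⟩
    · exact ⟨τ x, (free.act_swap_gen τ x).symm⟩
  | _ + 3 => trivial

theorem lowSpan_comp {m n : ℕ} {p : (free τ).obj (m + 1)} {q : (free τ).obj n}
    (hp : p ∈ lowSpan τ (m + 1)) (hq : q ∈ lowSpan τ n) :
    (free τ).comp p q ∈ lowSpan τ (m + n) := by
  match n with
  | 0 =>
    obtain rfl : q = 0 := hq
    exact (map_zero ((free τ).comp p)).symm ▸ Submodule.zero_mem _
  | 1 =>
    obtain ⟨c, rfl⟩ : ∃ c : K, c • (free τ).one = q := Submodule.mem_span_singleton.1 hq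
    rw [map_smul, (free τ).comp_one]; exact Submodule.smul_mem _ c hp
  | n + 2 =>
    match m with
    | 0 =>
      obtain ⟨c, rfl⟩ : ∃ c : K, c • (free τ).one = p := Submodule.mem_span_singleton.1 hp
      have h : (free τ).comp (m := 0) (c • (free τ).one) q = c • (free τ).comp (m := 0) (free τ).one q :=
        LinearMap.map_smul₂ _ c _ q
      rw [h, (free τ).one_comp]
      refine Submodule.smul_mem _ c ?_
      have : ∀ (k : ℕ) (h : n + 2 = k), (free τ).act (finCongr h) q ∈ lowSpan τ k := by
        rintro _ rfl
        exact lowSpan_act τ _ hq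
      exact this _ _
    | m + 1 =>
      have : ∀ (k : ℕ) (h : 3 ≤ k) (x : (free τ).obj k), x ∈ lowSpan τ k := by
        intro k h x
        obtain ⟨k, rfl⟩ := Nat.exists_eq_add_of_le' h
        trivial
      exact this _ (by omega) _

theorem mem_lowSpan : ∀ {n : ℕ} (p : (free τ).obj n), p ∈ lowSpan τ n := by
  suffices key : ∀ {n : ℕ} (p : OpTerm K E n), (FreeObj.mk p : (free τ).obj n) ∈ lowSpan τ n from
    fun {n} => Quot.ind fun p => key p
  intro n p
  induction p with
  | zero n => exact Submodule.zero_mem _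
  | add p q hp hq => exact Submodule.add_mem _ hp hq
  | smul c p hp => exact Submodule.smul_mem _ c hp
  | gen x => exact ⟨x, rfl⟩
  | act e p hp =>
    obtain rfl : _ = _ := Fin.equiv_iff_eq.1 ⟨e⟩
    exact lowSpan_act τ e hp
  | one => exact Submodule.mem_span_singleton_self (free τ).one
  | comp p q hp hq => exact lowSpan_comp τ hp hq

theorem finite_quadratic [FiniteDimensional K E] (R : Submodule K ((free τ).obj 3)) :
    FiniteDimensional K ((quadratic τ R).obj 2) := by
  refine Module.Finite.of_surjective (quadratic.gen τ R) fun p => ?_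
  obtain ⟨q, rfl⟩ := Submodule.Quotient.mk_surjective _ p
  obtain ⟨x, rfl⟩ := mem_lowSpan τ q
  exact ⟨x, rfl⟩

end Finite

theorem IsBinaryQuadratic.finite {P : SymOperad K} (h : P.IsBinaryQuadratic) :
    FiniteDimensional K (P.obj 2) := by
  obtain ⟨E, _, _, _, τ, _, R, ⟨f⟩⟩ := h
  have := finite_quadratic τ R
  refine Module.Finite.of_surjective (f.inv.app 2) fun p => ⟨f.hom.app 2 p, ?_⟩
  exact LinearMap.congr_fun (congrFun (congrArg Hom.app f.hom_inv_id) 2) p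


section Op

variable (K) in
/-- The category of finitely generated binary quadratic operads and morphisms of operads. -/
abbrev Op := ObjectProperty.FullSubcategory (IsBinaryQuadratic (K := K))

/-! ### The Manin white product -/

/-- The transposition acts diagonally on the generators `P(2) ⊗ Q(2)`. -/
def whiteSwap (P Q : SymOperad K) : P.obj 2 ⊗[K] Q.obj 2 →ₗ[K] P.obj 2 ⊗[K] Q.obj 2 :=
  TensorProduct.map P.swap Q.swap

/-- The morphism from the free operad on `P(2) ⊗ Q(2)` to the Hadamard product. -/
def whiteCompare (P Q : SymOperad K) : free (whiteSwap P Q) ⟶ hadamard P Q :=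
  free.lift LinearMap.id fun _ => rfl

/-- The ternary relations of the white product: those that hold in the Hadamard product, equivalently in
the tensor products of `P`-algebras and `Q`-algebras. -/
def whiteRel (P Q : SymOperad K) : Submodule K ((free (whiteSwap P Q)).obj 3) :=
  LinearMap.ker ((whiteCompare P Q).app 3)

/-- The Manin white product: the quadratic operad with generators `P(2) ⊗ Q(2)` and the relations
`whiteRel P Q`. -/
def white (P Q : SymOperad K) : SymOperad K := quadratic (whiteSwap P Q) (whiteRel P Q)

theorem white_isBinaryQuadratic {P Q : SymOperad K} (hP : P.IsBinaryQuadratic)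
    (hQ : Q.IsBinaryQuadratic) : (white P Q).IsBinaryQuadratic := by
  have := hP.finite
  have := hQ.finite
  refine ⟨_, _, _, inferInstanceAs (FiniteDimensional K (P.obj 2 ⊗[K] Q.obj 2)), whiteSwap P Q,
    fun p => ?_, whiteRel P Q, ⟨Iso.refl _⟩⟩
  induction p using TensorProduct.induction_on with
  | zero => simp
  | tmul a b => simp [whiteSwap, swap_swap]
  | add a b ha hb => simp only [map_add, ha, hb]

theorem hadamard_comp_tmul (P Q : SymOperad K) {m n : ℕ} (a : P.obj (m + 1)) (b : Q.obj (m + 1))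
    (c : P.obj n) (d : Q.obj n) :
    (hadamard P Q).comp (m := m) (n := n) (a ⊗ₜ[K] b) (c ⊗ₜ[K] d) =
      P.comp a c ⊗ₜ[K] Q.comp b d := rfl

/-- Functoriality of the Hadamard product. -/
def hadamardMap {P P' Q Q' : SymOperad K} (f : P ⟶ P') (g : Q ⟶ Q') :
    hadamard P Q ⟶ hadamard P' Q' where
  app n := TensorProduct.map (f.app n) (g.app n)
  map_act {m n} e := LinearMap.congr_fun
    (f := (TensorProduct.map (f.app n) (g.app n)).comp (TensorProduct.map (P.act e) (Q.act e)))
    (g := (TensorProduct.map (P'.act e) (Q'.act e)).comp (TensorProduct.map (f.app m) (g.app m)))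
    (TensorProduct.ext' fun a b => by simp [f.map_act, g.map_act])
  map_one := congrArg₂ (· ⊗ₜ[K] ·) f.map_one g.map_one
  map_comp {m n} p q := by
    have h : (TensorProduct.map₂ P.comp Q.comp).compr₂
        (TensorProduct.map (f.app (m + n)) (g.app (m + n))) =
        (TensorProduct.map₂ P'.comp Q'.comp).compl₁₂
          (TensorProduct.map (f.app (m + 1)) (g.app (m + 1)))
          (TensorProduct.map (f.app n) (g.app n)) :=
      TensorProduct.ext' fun a b => TensorProduct.ext' fun c d => by
        simp [f.map_comp, g.map_comp]
    exact LinearMap.congr_fun₂ h p q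

theorem whiteMap_swap {P P' Q Q' : SymOperad K} (f : P ⟶ P') (g : Q ⟶ Q')
    (x : P.obj 2 ⊗[K] Q.obj 2) :
    TensorProduct.map (f.app 2) (g.app 2) (whiteSwap P Q x) =
      whiteSwap P' Q' (TensorProduct.map (f.app 2) (g.app 2) x) :=
  (hadamardMap f g).map_act (Equiv.swap 0 1) x

/-- The generators of the white product. -/
def whiteGen (P Q : SymOperad K) : P.obj 2 ⊗[K] Q.obj 2 →ₗ[K] (white P Q).obj 2 :=
  quadratic.gen (whiteSwap P Q) (whiteRel P Q)

/-- Functoriality of the white product. -/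
def whiteMap {P P' Q Q' : SymOperad K} (f : P ⟶ P') (g : Q ⟶ Q') : white P Q ⟶ white P' Q' :=
  quadraticMap (TensorProduct.map (f.app 2) (g.app 2)) (whiteMap_swap f g) fun r hr => by
    have h : freeMap (TensorProduct.map (f.app 2) (g.app 2)) (whiteMap_swap f g) ≫
        whiteCompare P' Q' = whiteCompare P Q ≫ hadamardMap f g := free.hom_ext fun _ => rfl
    have h3 := LinearMap.congr_fun (congrFun (congrArg Hom.app h) 3) r
    refine LinearMap.mem_ker.2 (h3.trans ?_)
    exact (congrArg ((hadamardMap f g).app 3) hr).trans (map_zero _)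

/-- The functor `P ∘ -`. -/
def whiteFunctor (P : Op K) : Op K ⥤ Op K where
  obj Q := ⟨white P.obj Q.obj, white_isBinaryQuadratic P.property Q.property⟩
  map g := ObjectProperty.homMk (whiteMap (𝟙 P.obj) g.hom)
  map_id Q := by
    ext1
    exact quadratic.hom_ext fun x => congrArg (quadratic.gen _ _)
      (LinearMap.congr_fun TensorProduct.map_id x)
  map_comp {Q Q' Q''} f g := by
    ext1
    exact quadratic.hom_ext fun x => congrArg (quadratic.gen _ _)
      (LinearMap.congr_fun (TensorProduct.map_comp (LinearMap.id (M := P.obj.obj 2))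
        (g.hom.app 2) (LinearMap.id (M := P.obj.obj 2)) (f.hom.app 2)) x)

/-! ### The associative operad -/

variable (K) in
/-- The module over the symmetric group on two letters induced from the vector space `N`: the free operad on it is
freely generated by non-symmetric binary operations that depend linearly on `N`. The pair `(x, y)`
stands for (the operation `x`) + (the opposite of the operation `y`). -/
def regularSwap (N : Type u) [AddCommGroup N] [Module K N] : N × N →ₗ[K] N × N :=
  (LinearMap.snd K N N).prod (LinearMap.fst K N N)

variable (K) in
/-- One non-symmetric binary product. -/
def assProduct : (free (regularSwap K K)).obj 2 := free.gen (regularSwap K K) (1, 0)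

variable (K) in
/-- The associator `(x₀ x₁) x₂ - x₀ (x₁ x₂)`. -/
def assRelator : (free (regularSwap K K)).obj 3 :=
  (free (regularSwap K K)).act (finAddFlip (m := 1) (n := 2))
      ((free (regularSwap K K)).comp (m := 1) ((free (regularSwap K K)).swap (assProduct K))
        (assProduct K)) -
    (free (regularSwap K K)).comp (m := 1) (assProduct K) (assProduct K)

variable (K) in
/-- The operad of associative algebras. -/
def assOperad : SymOperad K := quadratic (regularSwap K K) (K ∙ assRelator K)

variable (K) in
/-- The operad of associative algebras, as an object of `Op K`. -/
def Ass : Op K :=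
  ⟨assOperad K, K × K, _, _, inferInstanceAs (FiniteDimensional K (K × K)), regularSwap K K,
    fun _ => rfl, _, ⟨Iso.refl _⟩⟩

variable (K) in
/-- The generating product of the associative operad. -/
def assCup : (Ass K).obj.obj 2 := quadratic.gen (regularSwap K K) (K ∙ assRelator K) (1, 0)

/-! ### Local dg algebras over an operad -/

/-- The Koszul sign of the rearrangement `(v₀, v₁, …) ↦ (v_{e 0}, v_{e 1}, …)` of homogeneous elements
`v i` of degrees `a i`. -/
def koszulSign {m n : ℕ} (e : Fin m ≃ Fin n) (a : Fin n → ℕ) : ℤˣ :=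
  ∏ i, ∏ j, if i < j ∧ e j < e i then (-1) ^ (a (e i) * a (e j)) else 1

/-- A structure of dg algebra over the operad `P` on the complex `C` with homogeneous components
`grade k` and differential `d`: operations of degree zero, compatible with the operad structure
(with the Koszul sign rule) and with `d` (the Leibniz rule). -/
structure DGAlgebra (P : SymOperad K) (C : Type u) [AddCommGroup C] [Module K C]
    (grade : ℕ → Submodule K C) (d : C →ₗ[K] C) where
  op (n : ℕ) : P.obj n →ₗ[K] MultilinearMap K (fun _ : Fin n => C) C
  op_one (v : Fin 1 → C) : op 1 P.one v = v 0
  op_comp {m n : ℕ} (p : P.obj (m + 1)) (q : P.obj n) (v : Fin (m + n) → C) :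
    op (m + n) (P.comp p q) v = op (m + 1) p (Fin.snoc (α := fun _ => C)
      (fun i => v (Fin.castAdd n i)) (op n q fun j => v (Fin.natAdd m j)))
  op_act {m n : ℕ} (e : Fin m ≃ Fin n) (p : P.obj m) (v : Fin n → C) (a : Fin n → ℕ)
    (hv : ∀ i, v i ∈ grade (a i)) :
    op n (P.act e p) v = (koszulSign e a : ℤ) • op m p fun i => v (e i)
  op_mem {n : ℕ} (p : P.obj n) (v : Fin n → C) (a : Fin n → ℕ) (hv : ∀ i, v i ∈ grade (a i)) :
    op n p v ∈ grade (∑ i, a i)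
  leibniz {n : ℕ} (p : P.obj n) (v : Fin n → C) (a : Fin n → ℕ) (hv : ∀ i, v i ∈ grade (a i)) :
    d (op n p v) =
      ∑ i, (-1 : ℤ) ^ (∑ j ∈ Finset.Iio i, a j) • op n p (Function.update v i (d (v i)))

/-- dg ideals of a dg algebra over an operad. -/
structure DGAlgebra.IsIdeal {P : SymOperad K} {C : Type u} [AddCommGroup C] [Module K C]
    {grade : ℕ → Submodule K C} {d : C →ₗ[K] C} (θ : DGAlgebra P C grade d) (I : Submodule K C) :
    Prop where
  d_mem {x : C} (hx : x ∈ I) : d x ∈ I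
  op_mem {n : ℕ} (p : P.obj n) (v : Fin n → C) (i : Fin n) (hi : v i ∈ I) : θ.op n p v ∈ I

section Cochain
variable (V : Type u) [AddCommGroup V] [Module K V]

/-- The non-degenerate cochains `C^*(Δ₁; V)`: the first component of `c` holds the values on the left
vertex `0` and on the right vertex `1`, the second one the value on the edge. -/
abbrev Cochain : Type u := (Fin 2 → V) × V

namespace Cochain

variable (K) in
/-- `C^0`: cochains vanishing on the edge; `C^1`: cochains vanishing on the vertices. -/
def grade : ℕ → Submodule K (Cochain V)
  | 0 => LinearMap.ker (LinearMap.snd K (Fin 2 → V) V)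
  | 1 => LinearMap.ker (LinearMap.fst K (Fin 2 → V) V)
  | _ + 2 => ⊥

variable (K) in
/-- The differential: `(x, y) ↦ y - x` from `C^0` to `C^1`. -/
def d : Cochain V →ₗ[K] Cochain V where
  toFun c := (0, c.1 1 - c.1 0)
  map_add' c c' := by ext <;> simp; abel
  map_smul' r c := by ext <;> simp [smul_sub]

variable (K) in
/-- The relative cochains `C^*(Δ₁, X; V)` for a set `X` of vertices. -/
def relative (X : Set (Fin 2)) : Submodule K (Cochain V) where
  carrier := {c | ∀ i ∈ X, c.1 i = 0}
  add_mem' h h' i hi := by simp [h i hi, h' i hi]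
  zero_mem' _ _ := rfl
  smul_mem' r c h i hi := by simp [h i hi]

variable {V}

/-- The cup product of cochains, with coefficients multiplied by `μ`: the tensor product of the cup
product on `C^*(Δ₁; K)` and of `μ`. -/
def cup (μ : V → V → V) (a b : Cochain V) : Cochain V :=
  (fun i => μ (a.1 i) (b.1 i), μ (a.1 0) b.2 + μ a.2 (b.1 1))

end Cochain

/-- Local dg algebra structures over `P` on `C^*(Δ₁; V)`: all relative cochains are dg ideals. -/
structure LocalDGAlgebra (P : SymOperad K) extends
    DGAlgebra P (Cochain V) (Cochain.grade K V) (Cochain.d K V) where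
  isIdeal_relative (X : Set (Fin 2)) : toDGAlgebra.IsIdeal (Cochain.relative K V X)

variable {V}

/-- The binary operation `μ` of a `P`-algebra `V`. -/
def binaryOp {P : SymOperad K} (A : P ⟶ endOperad V) (μ : P.obj 2) (x y : V) : V :=
  (show MultilinearMap K (fun _ : Fin 2 => V) V from A.app 2 μ) ![x, y]

/-- Given a `P`-algebra `V`, the operation `g μ` on `C^*(Δ₁; V)` is the cup product with coefficients
multiplied by `μ`, for all `μ`. -/
def LocalDGAlgebra.IsCup {P Q : SymOperad K} (θ : LocalDGAlgebra V Q) (A : P ⟶ endOperad V)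
    (g : P.obj 2 → Q.obj 2) : Prop :=
  ∀ (μ : P.obj 2) (a b : Cochain V), θ.op 2 (g μ) ![a, b] = Cochain.cup (binaryOp A μ) a b

end Cochain

/-! ### The functor given by the cup products on `C^*(Δ₁; V)` -/

/-- The non-symmetric generator `∪ ⊗ μ`. -/
def cupGen (P : SymOperad K) (μ : P.obj 2) : (free (regularSwap K (P.obj 2))).obj 2 :=
  free.gen _ (μ, 0)

/-- Restriction along a morphism of operads. -/
def DGAlgebra.comap {P Q : SymOperad K} {C : Type u} [AddCommGroup C] [Module K C]
    {grade : ℕ → Submodule K C} {d : C →ₗ[K] C} (f : P ⟶ Q) (θ : DGAlgebra Q C grade d) :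
    DGAlgebra P C grade d where
  op n := (θ.op n).comp (f.app n)
  op_one v := by simp [f.map_one, θ.op_one]
  op_comp p q v := by simp [f.map_comp, θ.op_comp]
  op_act e p v a hv := by simp [f.map_act, θ.op_act e _ v a hv]
  op_mem p v a hv := θ.op_mem _ v a hv
  leibniz p v a hv := θ.leibniz _ v a hv

/-- Restriction along a morphism of operads. -/
def LocalDGAlgebra.comap {P Q : SymOperad K} {V : Type u} [AddCommGroup V] [Module K V]
    (f : P ⟶ Q) (θ : LocalDGAlgebra V Q) : LocalDGAlgebra V P where
  toDGAlgebra := θ.toDGAlgebra.comap f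
  isIdeal_relative X := ⟨(θ.isIdeal_relative X).d_mem, fun _ => (θ.isIdeal_relative X).op_mem _⟩

/-- The largest space of ternary relations `R` between the operations `∪ ⊗ μ` such that `R = 0` holds
for the local dg algebra structure given by the cup products on `C^*(Δ₁; V)`, for every `P`-algebra
`V`. -/
def assCircRel (P : SymOperad K) : Submodule K ((free (regularSwap K (P.obj 2))).obj 3) where
  carrier := {R | ∀ (V : Type u) [AddCommGroup V] [Module K V] (A : P ⟶ endOperad V)
    (θ : LocalDGAlgebra V (free (regularSwap K (P.obj 2)))), θ.IsCup A (cupGen P) → θ.op 3 R = 0}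
  add_mem' h h' V _ _ A θ hθ := by rw [map_add, h V A θ hθ, h' V A θ hθ, add_zero]
  zero_mem' V _ _ A θ hθ := map_zero _
  smul_mem' c R h V _ _ A θ hθ := by rw [map_smul, h V A θ hθ, smul_zero]

/-- The operad generated by non-symmetric operations `∪ ⊗ μ`, linear in `μ ∈ P(2)`, with all the
relations that hold for the cup products on `C^*(Δ₁; V)`, for every `P`-algebra `V`. For a basis of `P(2)` given by non-symmetric
products and their opposites, commutative products and anti-commutative brackets, the generators are
`≺ᵢ = ∪ ⊗ ·ᵢ`, `≻ᵢ = ∪ ⊗ ·ᵢ^op`, `∘ⱼ = ∪ ⊗ •ⱼ` and `∗ₖ = ∪ ⊗ [-,-]ₖ`. -/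
def assCirc (P : SymOperad K) : SymOperad K :=
  quadratic (regularSwap K (P.obj 2)) (assCircRel P)

theorem assCirc_isBinaryQuadratic {P : SymOperad K} (hP : P.IsBinaryQuadratic) :
    (assCirc P).IsBinaryQuadratic := by
  have := hP.finite
  exact ⟨_, _, _, inferInstanceAs (FiniteDimensional K (P.obj 2 × P.obj 2)), _,
    fun _ => rfl, assCircRel P, ⟨Iso.refl _⟩⟩

/-- Functoriality: `∪ ⊗ μ ↦ ∪ ⊗ f μ`. -/
def assCircMap {P Q : SymOperad K} (f : P ⟶ Q) : assCirc P ⟶ assCirc Q :=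
  quadraticMap ((f.app 2).prodMap (f.app 2)) (fun _ => rfl) fun R hR V _ _ A θ hθ =>
    hR V (f ≫ A) (θ.comap (freeMap ((f.app 2).prodMap (f.app 2)) fun _ => rfl)) fun μ a b => by
      have h : (freeMap ((f.app 2).prodMap (f.app 2)) (fun _ => rfl)).app 2 (cupGen P μ) =
          cupGen Q (f.app 2 μ) := congrArg (free.gen _) (Prod.ext rfl (map_zero (f.app 2)))
      exact (congrArg (fun r => θ.op 2 r ![a, b]) h).trans (hθ (f.app 2 μ) a b)

variable (K) in
/-- The functor `assCirc`. -/
def assCircFunctor : Op K ⥤ Op K where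
  obj P := ⟨assCirc P.obj, assCirc_isBinaryQuadratic P.property⟩
  map f := ObjectProperty.homMk (assCircMap f.hom)
  map_id P := by
    ext1
    exact quadratic.hom_ext fun x => rfl
  map_comp f g := by
    ext1
    exact quadratic.hom_ext fun x => rfl

/-- The generating operation `∪ ⊗ μ` of `assCirc P`. -/
def assCircCup (P : SymOperad K) (μ : P.obj 2) : (assCirc P).obj 2 :=
  quadratic.gen (regularSwap K (P.obj 2)) (assCircRel P) (μ, 0)

end Op
end SymOperad
end

/-! Both operads are generated by the same `S₂`-module. A pair `(μ, ν)` stands for `∪ ⊗ μ` plus the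
opposite of `∪ ⊗ ν`, and the transposition acts diagonally on `Ass(2) ⊗ P(2)`, so the pair
corresponds to `∪ ⊗ μ + ∪^op ⊗ ν^op` (`cupEquiv`). It remains to show that the ternary relations
agree: an element of the free operad acts by zero on `C^*(Δ₁; V)` for every `P`-algebra `V` exactly
when its image in `Ass(3) ⊗ P(3)` vanishes (`mem_assCircRel_iff`).

One direction holds because `C^*(Δ₁; K)` is an associative algebra and `C^*(Δ₁; V)` is its tensor
product with `V`: the action by cup products factors through the Hadamard product (`cupHom_tmul`).

For the other direction, write the image as a sum over permutations `e` of `act e T ⊗ o e`, where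
`T` is the triple product of `Ass`. Among all orders of the left vertex, the edge and the right
vertex, only this one has a nonzero triple cup product, namely the edge (`opOf_assTriple_cell`).
Inserting these three cochains in a suitable order, with coefficients in `V`, therefore isolates a
single `o e` acting on `V`. To conclude that `o e = 0`, an algebra is needed on which `P(3)` acts
faithfully. The multilinear part of the free `P`-algebra on three generators serves, in every
characteristic; since `P` is quadratic, only its binary products have to be defined and only its
ternary relations checked (`exists_faithful_quadratic`).

The local dg structure exists because cochains live in degrees `0` and `1`. An operation with inputs
of total degree at least two vanishes, so no Koszul sign ever matters and the Leibniz rule has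
content only on vertex cochains (`localDGOfHom`). For the same reason a local dg structure is an
ordinary algebra structure on the underlying space, determined by its binary cup products. -/

noncomputable section

namespace SymOperad

variable {K : Type u} [Field K]

/-! ### Ternary operations of a free operad on binary generators -/

section FreeInduction
variable {E : Type u} [AddCommGroup E] [Module K E] {τ : E →ₗ[K] E}

/-- To prove a property of all elements of a free operad, it suffices to prove it for the generators and
to show that it is stable under the structure operations. -/
theorem free.induction {motive : ∀ {n : ℕ}, (free τ).obj n → Prop}
    (zero : ∀ n, motive (0 : (free τ).obj n))
    (add : ∀ {n} (p q : (free τ).obj n), motive p → motive q → motive (p + q))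
    (smul : ∀ {n} (c : K) (p : (free τ).obj n), motive p → motive (c • p))
    (gen : ∀ x, motive (free.gen τ x))
    (act : ∀ {m n} (e : Fin m ≃ Fin n) (p : (free τ).obj m), motive p →
      motive ((free τ).act e p))
    (one : motive (free τ).one)
    (comp : ∀ {m n} (p : (free τ).obj (m + 1)) (q : (free τ).obj n), motive p → motive q →
      motive ((free τ).comp p q))
    {n : ℕ} (p : (free τ).obj n) : motive p := by
  suffices key : ∀ {n : ℕ} (p : OpTerm K E n), motive (FreeObj.mk p : (free τ).obj n) from
    Quot.ind (fun p => key p) p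
  intro n p
  induction p with
  | zero n => exact zero n
  | add p q hp hq => exact add _ _ hp hq
  | smul c p hp => exact smul c _ hp
  | gen x => exact gen x
  | act e p hp => exact act e _ hp
  | one => exact one
  | comp p q hp hq => exact comp _ _ hp hq

variable (τ) in
/-- The ternary operations `x (y)` with renamed inputs, for generators `x` and `y`. -/
def ternarySpan : Submodule K ((free τ).obj 3) :=
  Submodule.span K {p | ∃ (e : Fin 3 ≃ Fin 3) (x y : E),
    p = (free τ).act e ((free τ).comp (m := 1) (n := 2) (free.gen τ x) (free.gen τ y))}

theorem act_mem_ternarySpan (e : Fin 3 ≃ Fin 3) {p : (free τ).obj 3} (hp : p ∈ ternarySpan τ) :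
    (free τ).act e p ∈ ternarySpan τ := by
  induction hp using Submodule.span_induction with
  | mem p hp =>
    obtain ⟨f, x, y, rfl⟩ := hp
    exact Submodule.subset_span ⟨f.trans e, x, y, ((free τ).act_trans _ _ _).symm⟩
  | zero => rw [map_zero]; exact Submodule.zero_mem _
  | add p q _ _ hp hq => rw [map_add]; exact Submodule.add_mem _ hp hq
  | smul c p _ hp => rw [map_smul]; exact Submodule.smul_mem _ c hp

/-- By `mem_lowSpan` there is nothing in arity 0, only scalars in arity 1 and only generators in
arity 2. So a composite of arity 3 is zero, a multiple of one of its two factors, or a composite of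
two generators. -/
theorem comp_mem_ternarySpan {m n : ℕ} (h : m + n = 3) (p : (free τ).obj (m + 1))
    (q : (free τ).obj n) (hp : ∀ h : m + 1 = 3, (free τ).act (finCongr h) p ∈ ternarySpan τ)
    (hq : ∀ h : n = 3, (free τ).act (finCongr h) q ∈ ternarySpan τ) :
    (free τ).act (finCongr h) ((free τ).comp p q) ∈ ternarySpan τ := by
  match n with
  | 0 =>
    obtain rfl : q = 0 := mem_lowSpan τ q
    rw [map_zero, map_zero]; exact Submodule.zero_mem _
  | 1 =>
    obtain ⟨c, rfl⟩ : ∃ c : K, c • (free τ).one = q :=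
      Submodule.mem_span_singleton.1 (mem_lowSpan τ q)
    rw [map_smul, (free τ).comp_one, map_smul]
    exact Submodule.smul_mem _ c (hp h)
  | 2 =>
    obtain rfl : m = 1 := by omega
    obtain ⟨x, rfl⟩ := mem_lowSpan τ p
    obtain ⟨y, rfl⟩ := mem_lowSpan τ q
    exact Submodule.subset_span ⟨_, x, y, rfl⟩
  | 3 =>
    obtain rfl : m = 0 := by omega
    obtain ⟨c, rfl⟩ : ∃ c : K, c • (free τ).one = p :=
      Submodule.mem_span_singleton.1 (mem_lowSpan τ p)
    have h1 : (free τ).comp (m := 0) (c • (free τ).one) q =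
        c • (free τ).comp (m := 0) (free τ).one q := LinearMap.map_smul₂ _ c _ q
    rw [h1, (free τ).one_comp, map_smul, ← (free τ).act_trans]
    exact Submodule.smul_mem _ c (hq rfl)
  | _ + 4 => omega

theorem mem_ternarySpan (p : (free τ).obj 3) : p ∈ ternarySpan τ := by
  -- The induction runs through all arities at once, so the arity is a variable and the claim is
  -- transported along `n = 3`.
  suffices key : ∀ {n : ℕ} (p : (free τ).obj n) (h : n = 3),
      (free τ).act (finCongr h) p ∈ ternarySpan τ by
    have := key p rfl
    rwa [finCongr_refl, (free τ).act_refl] at this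
  intro n p
  induction p using free.induction with
  | zero n => intro h; rw [map_zero]; exact Submodule.zero_mem _
  | add p q hp hq => intro h; rw [map_add]; exact Submodule.add_mem _ (hp h) (hq h)
  | smul c p hp => intro h; rw [map_smul]; exact Submodule.smul_mem _ c (hp h)
  | gen x => intro h; omega
  | act e p hp =>
    intro h
    subst h
    obtain rfl : _ = 3 := Fin.equiv_iff_eq.1 ⟨e⟩
    have := hp rfl
    rw [finCongr_refl, (free τ).act_refl] at this ⊢
    exact act_mem_ternarySpan e this
  | one => intro h; omega
  | comp p q hp hq => exact fun h => comp_mem_ternarySpan h p q hp hq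

/-- A linear identity between ternary operations in a free operad holds if it holds for the operations
`x (y)` with renamed inputs. -/
theorem ternary_ext {W : Type*} [AddCommGroup W] [Module K W] {f g : (free τ).obj 3 →ₗ[K] W}
    (h : ∀ (e : Fin 3 ≃ Fin 3) (x y : E),
      f ((free τ).act e ((free τ).comp (m := 1) (n := 2) (free.gen τ x) (free.gen τ y))) =
      g ((free τ).act e ((free τ).comp (m := 1) (n := 2) (free.gen τ x) (free.gen τ y)))) :
    f = g := by
  ext p
  induction mem_ternarySpan p using Submodule.span_induction with
  | mem p hp => obtain ⟨e, x, y, rfl⟩ := hp; exact h e x y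
  | zero => rw [map_zero, map_zero]
  | add p q _ _ hp hq => rw [map_add, map_add, hp, hq]
  | smul c p _ hp => rw [map_smul, map_smul, hp]

end FreeInduction

/-! ### Evaluating operations of an algebra, and bilinear maps -/

section Operations
variable {V : Type u} [AddCommGroup V] [Module K V] {P : SymOperad K}

/-- The operations of an algebra over an operad. -/
def opOf (A : P ⟶ endOperad V) (n : ℕ) : P.obj n →ₗ[K] MultilinearMap K (fun _ : Fin n => V) V :=
  A.app n

theorem opOf_act (A : P ⟶ endOperad V) {m n : ℕ} (e : Fin m ≃ Fin n) (p : P.obj m)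
    (v : Fin n → V) : opOf A n (P.act e p) v = opOf A m p fun i => v (e i) :=
  congrArg (fun f : MultilinearMap K (fun _ : Fin n => V) V => f v) (A.map_act e p)

theorem opOf_one (A : P ⟶ endOperad V) (v : Fin 1 → V) : opOf A 1 P.one v = v 0 :=
  congrArg (fun f : MultilinearMap K (fun _ : Fin 1 => V) V => f v) A.map_one

theorem opOf_comp (A : P ⟶ endOperad V) {m n : ℕ} (p : P.obj (m + 1)) (q : P.obj n)
    (v : Fin (m + n) → V) : opOf A (m + n) (P.comp p q) v =
      opOf A (m + 1) p (Fin.snoc (α := fun _ => V) (fun i => v (Fin.castAdd n i))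
        (opOf A n q fun j => v (Fin.natAdd m j))) :=
  congrArg (fun f : MultilinearMap K (fun _ : Fin (m + n) => V) V => f v) (A.map_comp p q)

theorem opOf_comp_two (A : P ⟶ endOperad V) (p q : P.obj 2) (v : Fin 3 → V) :
    opOf A 3 (P.comp (m := 1) (n := 2) p q) v = opOf A 2 p ![v 0, opOf A 2 q ![v 1, v 2]] := by
  refine (opOf_comp A (m := 1) (n := 2) p q v).trans ?_
  congr 1
  ext i
  fin_cases i
  · rfl
  · refine congrArg (opOf A 2 q) ?_
    ext j
    fin_cases j <;> rfl

theorem opOf_swap (A : P ⟶ endOperad V) (p : P.obj 2) (v : Fin 2 → V) :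
    opOf A 2 (P.swap p) v = opOf A 2 p ![v 1, v 0] := by
  refine (opOf_act A (Equiv.swap 0 1) p v).trans ?_
  congr 1
  ext i
  fin_cases i <;> rfl

end Operations

section Pair
variable {V W : Type u} [AddCommGroup V] [Module K V] [AddCommGroup W] [Module K W]
  (f : MultilinearMap K (fun _ : Fin 2 => V) W)

theorem map_pair_add_left (x y z : V) : f ![x + y, z] = f ![x, z] + f ![y, z] :=
  f.cons_add ![z] x y

theorem map_pair_smul_left (c : K) (x z : V) : f ![c • x, z] = c • f ![x, z] :=
  f.cons_smul ![z] c x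

theorem map_pair_add_right (x y z : V) : f ![x, y + z] = f ![x, y] + f ![x, z] := by
  have h : ∀ w : V, Function.update ![x, 0] 1 w = ![x, w] := fun w => by
    ext i; fin_cases i <;> rfl
  simpa only [h] using f.map_update_add ![x, 0] 1 y z

theorem map_pair_smul_right (c : K) (x z : V) : f ![x, c • z] = c • f ![x, z] := by
  have h : ∀ w : V, Function.update ![x, 0] 1 w = ![x, w] := fun w => by
    ext i; fin_cases i <;> rfl
  simpa only [h] using f.map_update_smul ![x, 0] 1 c z

theorem map_pair_zero_left (x : V) : f ![0, x] = 0 := f.map_coord_zero 0 rfl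

theorem map_pair_zero_right (x : V) : f ![x, 0] = 0 := f.map_coord_zero 1 rfl

/-- A multilinear map as a linear function of its last argument. -/
def lastLinear {n : ℕ} (f : MultilinearMap K (fun _ : Fin (n + 1) => V) W) (v : Fin n → V) :
    V →ₗ[K] W where
  toFun w := f (Fin.snoc (α := fun _ => V) v w)
  map_add' _ _ := f.snoc_add _ _ _
  map_smul' _ _ := f.snoc_smul _ _ _

/-- A bilinear map as a multilinear map. -/
def ofBilinear (b : V →ₗ[K] V →ₗ[K] W) : MultilinearMap K (fun _ : Fin 2 => V) W :=
  MultilinearMap.mk' (fun v => b (v 0) (v 1))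
    (fun v i x y => by fin_cases i <;> simp)
    (fun v i c x => by fin_cases i <;> simp)

@[simp] theorem ofBilinear_apply (b : V →ₗ[K] V →ₗ[K] W) (v : Fin 2 → V) :
    ofBilinear b v = b (v 0) (v 1) := rfl

end Pair

/-! ### Cup products as an action of the free operad -/

section CupProduct
variable {V : Type u} [AddCommGroup V] [Module K V]

/-- The cup product of cochains with coefficients multiplied by a bilinear operation. -/
def cupMultilinear (f : MultilinearMap K (fun _ : Fin 2 => V) V) :
    MultilinearMap K (fun _ : Fin 2 => Cochain V) (Cochain V) :=
  MultilinearMap.mk' (fun v => Cochain.cup (fun x y => f ![x, y]) (v 0) (v 1))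
    (fun v i x y => by
      fin_cases i <;> ext <;>
        simp [Cochain.cup, map_pair_add_left, map_pair_add_right] <;> abel)
    (fun v i c x => by
      fin_cases i <;> ext <;>
        simp [Cochain.cup, map_pair_smul_left, map_pair_smul_right])

theorem cupMultilinear_apply (f : MultilinearMap K (fun _ : Fin 2 => V) V)
    (v : Fin 2 → Cochain V) :
    cupMultilinear f v = Cochain.cup (fun x y => f ![x, y]) (v 0) (v 1) := rfl

/-- `cupMultilinear` as a linear map. -/
def cupLinear : MultilinearMap K (fun _ : Fin 2 => V) V →ₗ[K]
    MultilinearMap K (fun _ : Fin 2 => Cochain V) (Cochain V) where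
  toFun := cupMultilinear
  map_add' f g := by
    ext <;> simp [Cochain.cup, cupMultilinear_apply]
    abel
  map_smul' c f := by
    ext <;> simp [Cochain.cup, cupMultilinear_apply]

/-- The operation given by a pair of bilinear operations: the sum of the cup product for the first one
and of the opposite of the cup product for the second one. -/
def cupPair {N : Type u} [AddCommGroup N] [Module K N]
    (b : N →ₗ[K] MultilinearMap K (fun _ : Fin 2 => V) V) :
    N × N →ₗ[K] (endOperad (K := K) (Cochain V)).obj 2 :=
  (cupLinear.comp b).coprod ((endOperad (K := K) (Cochain V)).swap.comp (cupLinear.comp b))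

theorem cupPair_apply {N : Type u} [AddCommGroup N] [Module K N]
    (b : N →ₗ[K] MultilinearMap K (fun _ : Fin 2 => V) V) (x : N × N) (v : Fin 2 → Cochain V) :
    (show MultilinearMap K (fun _ : Fin 2 => Cochain V) (Cochain V) from cupPair b x) v =
      Cochain.cup (fun y z => b x.1 ![y, z]) (v 0) (v 1) +
        Cochain.cup (fun y z => b x.2 ![y, z]) (v 1) (v 0) := rfl

/-- The action of the free operad by cup products. -/
def cupHom {N : Type u} [AddCommGroup N] [Module K N]
    (b : N →ₗ[K] MultilinearMap K (fun _ : Fin 2 => V) V) :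
    free (regularSwap K N) ⟶ endOperad (K := K) (Cochain V) :=
  free.lift (cupPair b) fun x => MultilinearMap.ext fun v => by
    refine (cupPair_apply b _ v).trans ((add_comm _ _).trans
      (cupPair_apply b x fun i => v (Equiv.swap 0 1 i)).symm)

theorem cupHom_gen {N : Type u} [AddCommGroup N] [Module K N]
    (b : N →ₗ[K] MultilinearMap K (fun _ : Fin 2 => V) V) (x : N × N) (v : Fin 2 → Cochain V) :
    opOf (cupHom b) 2 (free.gen _ x) v = Cochain.cup (fun y z => b x.1 ![y, z]) (v 0) (v 1) +
        Cochain.cup (fun y z => b x.2 ![y, z]) (v 1) (v 0) := rfl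

end CupProduct

/-! ### Degree, Leibniz rule and locality for cup products -/

section LocalDG
variable {V : Type u} [AddCommGroup V] [Module K V]
open Cochain

theorem Cochain.mem_grade_zero {c : Cochain V} : c ∈ grade K V 0 ↔ c.2 = 0 := Iff.rfl

theorem Cochain.mem_grade_one {c : Cochain V} : c ∈ grade K V 1 ↔ c.1 = 0 := Iff.rfl

theorem Cochain.d_mem {k : ℕ} {c : Cochain V} (hc : c ∈ grade K V k) :
    Cochain.d K V c ∈ grade K V (k + 1) := by
  match k with
  | 0 => rfl
  | 1 =>
    have h : c.1 = 0 := hc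
    change Cochain.d K V c = 0
    ext <;> simp [Cochain.d, h]
  | k + 2 =>
    obtain rfl : c = 0 := hc
    rw [map_zero]; exact Submodule.zero_mem _

theorem Cochain.eq_zero_of_mem {k : ℕ} (hk : 2 ≤ k) {c : Cochain V} (hc : c ∈ grade K V k) :
    c = 0 := by
  obtain ⟨k, rfl⟩ := Nat.exists_eq_add_of_le' hk
  exact hc

/-- The multilinear operations on cochains which preserve degrees and relative cochains and satisfy the
Leibniz rule on vertex cochains. -/
structure IsLocalDG {n : ℕ} (f : MultilinearMap K (fun _ : Fin n => Cochain V) (Cochain V)) :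
    Prop where
  mem (v : Fin n → Cochain V) (a : Fin n → ℕ) (hv : ∀ i, v i ∈ grade K V (a i)) :
    f v ∈ grade K V (∑ i, a i)
  leibniz (v : Fin n → Cochain V) (hv : ∀ i, v i ∈ grade K V 0) :
    Cochain.d K V (f v) = ∑ i, f (Function.update v i (Cochain.d K V (v i)))
  relative (X : Set (Fin 2)) (v : Fin n → Cochain V) (i : Fin n)
    (hi : v i ∈ Cochain.relative K V X) : f v ∈ Cochain.relative K V X

namespace IsLocalDG
variable {m n : ℕ}

theorem zero : IsLocalDG (0 : MultilinearMap K (fun _ : Fin n => Cochain V) (Cochain V)) where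
  mem _ _ _ := Submodule.zero_mem _
  leibniz _ _ := by simp
  relative _ _ _ _ := Submodule.zero_mem _

theorem add {f g : MultilinearMap K (fun _ : Fin n => Cochain V) (Cochain V)}
    (hf : IsLocalDG f) (hg : IsLocalDG g) : IsLocalDG (f + g) where
  mem v a hv := Submodule.add_mem _ (hf.mem v a hv) (hg.mem v a hv)
  leibniz v hv := by
    simp only [add_apply, map_add, hf.leibniz v hv, hg.leibniz v hv,
      Finset.sum_add_distrib]
  relative X v i hi := Submodule.add_mem _ (hf.relative X v i hi) (hg.relative X v i hi)

theorem smul (c : K) {f : MultilinearMap K (fun _ : Fin n => Cochain V) (Cochain V)}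
    (hf : IsLocalDG f) : IsLocalDG (c • f) where
  mem v a hv := Submodule.smul_mem _ c (hf.mem v a hv)
  leibniz v hv := by
    simp only [smul_apply, map_smul, hf.leibniz v hv, Finset.smul_sum]
  relative X v i hi := Submodule.smul_mem _ c (hf.relative X v i hi)

theorem domDomCongr (e : Fin m ≃ Fin n)
    {f : MultilinearMap K (fun _ : Fin m => Cochain V) (Cochain V)} (hf : IsLocalDG f) :
    IsLocalDG (f.domDomCongr e) where
  mem v a hv := by
    rw [← Equiv.sum_comp e a]
    exact hf.mem _ _ fun i => hv (e i)
  leibniz v hv := by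
    rw [← Equiv.sum_comp e]
    refine (hf.leibniz _ fun i => hv (e i)).trans (Finset.sum_congr rfl fun i _ => ?_)
    refine congrArg f (funext fun j => ?_)
    simp [Function.update_apply]
  relative X v i hi := hf.relative X _ (e.symm i) (by simpa using hi)

theorem ofSubsingleton : IsLocalDG
    (MultilinearMap.ofSubsingleton K (Cochain V) (Cochain V) (0 : Fin 1) LinearMap.id) where
  mem v a hv := by simpa using hv 0
  leibniz v hv := by simp
  relative X v i hi := by
    obtain rfl := Subsingleton.elim i 0
    exact hi

/-- The Leibniz rule on vertex cochains survives composition because `g` maps vertex cochains to a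
vertex cochain, so the rule for `f` applies. Its last summand is then expanded by the rule for `g`
and linearity in the last argument. -/
theorem insertLast {f : MultilinearMap K (fun _ : Fin (m + 1) => Cochain V) (Cochain V)}
    {g : MultilinearMap K (fun _ : Fin n => Cochain V) (Cochain V)}
    (hf : IsLocalDG f) (hg : IsLocalDG g) : IsLocalDG (insertLast f g) where
  mem v a hv := by
    have h := hf.mem (Fin.snoc (α := fun _ => Cochain V) (fun i => v (Fin.castAdd n i))
      (g fun j => v (Fin.natAdd m j)))
      (Fin.snoc (α := fun _ => ℕ) (fun i => a (Fin.castAdd n i)) (∑ j, a (Fin.natAdd m j)))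
      fun i => by
        induction i using Fin.lastCases with
        | last => simpa only [Fin.snoc_last] using hg.mem _ _ fun j => hv _
        | cast i => simpa only [Fin.snoc_castSucc] using hv _
    rw [Fin.sum_univ_add, insertLast_apply]
    simpa only [Fin.sum_univ_castSucc, Fin.snoc_castSucc, Fin.snoc_last] using h
  leibniz v hv := by
    have h0 : g (fun j => v (Fin.natAdd m j)) ∈ grade K V 0 := by
      simpa using hg.mem _ (fun _ => 0) fun j => hv (Fin.natAdd m j)
    have h := hf.leibniz (Fin.snoc (α := fun _ => Cochain V) (fun i => v (Fin.castAdd n i))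
      (g fun j => v (Fin.natAdd m j))) fun i => by
        induction i using Fin.lastCases with
        | last => simpa only [Fin.snoc_last] using h0
        | cast i => simpa only [Fin.snoc_castSucc] using hv _
    rw [insertLast_apply, h, Fin.sum_univ_castSucc, Fin.sum_univ_add]
    congr 1
    · refine Finset.sum_congr rfl fun i _ => ?_
      rw [insertLast_apply, update_left, update_left_right, Fin.snoc_update, Fin.snoc_castSucc]
    · rw [Fin.snoc_last, Fin.update_snoc_last, hg.leibniz _ fun j => hv (Fin.natAdd m j)]
      simp only [insertLast_apply, update_right, update_right_left]
      exact map_sum (lastLinear f fun i => v (Fin.castAdd n i)) _ _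
  relative X v i hi := by
    induction i using Fin.addCases with
    | left i => exact hf.relative X _ i.castSucc (by simpa only [Fin.snoc_castSucc] using hi)
    | right i =>
      exact hf.relative X _ (Fin.last m)
        (by simpa only [Fin.snoc_last] using hg.relative X _ i hi)

theorem cupMultilinear (f : MultilinearMap K (fun _ : Fin 2 => V) V) :
    IsLocalDG (cupMultilinear f) where
  mem v a hv := by
    rw [Fin.sum_univ_two, cupMultilinear_apply]
    have h0 := hv 0
    have h1 := hv 1
    generalize a 0 = k at *
    generalize a 1 = l at *
    generalize v 0 = x at *
    generalize v 1 = y at *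
    have hz : ∀ {k} {x : Cochain V}, x ∈ grade K V (k + 2) → x = 0 :=
      fun h => Cochain.eq_zero_of_mem (by omega) h
    match k, l with
    | 0, 0 =>
      have h0 : x.2 = 0 := h0
      have h1 : y.2 = 0 := h1
      change Cochain.cup _ x y ∈ grade K V 0
      refine Cochain.mem_grade_zero.2 ?_
      simp [Cochain.cup, h0, h1, map_pair_zero_left, map_pair_zero_right]
    | 0, 1 =>
      have h1 : y.1 = 0 := h1
      change Cochain.cup _ x y ∈ grade K V 1
      refine Cochain.mem_grade_one.2 ?_
      ext
      simp [Cochain.cup, h1, map_pair_zero_right]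
    | 1, 0 =>
      have h0 : x.1 = 0 := h0
      change Cochain.cup _ x y ∈ grade K V 1
      refine Cochain.mem_grade_one.2 ?_
      ext
      simp [Cochain.cup, h0, map_pair_zero_left]
    | 1, 1 =>
      have h0 : x.1 = 0 := h0
      have h1 : y.1 = 0 := h1
      change Cochain.cup _ x y = 0
      ext <;> simp [Cochain.cup, h0, h1, map_pair_zero_left, map_pair_zero_right]
    | k + 2, l =>
      have : Cochain.cup (fun x y => f ![x, y]) x y = 0 := by
        rw [hz h0]
        ext <;> simp [Cochain.cup, map_pair_zero_left]
      rw [this]; exact Submodule.zero_mem _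
    | 0, l + 2 | 1, l + 2 =>
      have : Cochain.cup (fun x y => f ![x, y]) x y = 0 := by
        rw [hz h1]
        ext <;> simp [Cochain.cup, map_pair_zero_right]
      rw [this]; exact Submodule.zero_mem _
  leibniz v hv := by
    -- The Leibniz rule on the edge: `a₁b₁ - a₀b₀ = a₀(b₁ - b₀) + (a₁ - a₀)b₁`. It matches the
    -- convention that the cup product uses the left vertex of the first factor and the right vertex
    -- of the second.
    have hsub : ∀ x y z w : V, f ![x, y] - f ![z, w] = f ![z, y - w] + f ![x - z, y] := by
      intro x y z w
      have h1 := map_pair_add_right f z (y - w) w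
      have h2 := map_pair_add_left f (x - z) z y
      rw [sub_add_cancel] at h1 h2
      rw [h2, h1]; abel
    ext
    · simp [Cochain.d, Cochain.cup, cupMultilinear_apply, map_pair_zero_left, map_pair_zero_right]
    · simp [Cochain.d, Cochain.cup, cupMultilinear_apply, map_pair_zero_left, map_pair_zero_right,
        hsub, add_comm]
  relative X v i hi := by
    intro k hk
    have := hi k hk
    fin_cases i <;>
      simp_all [Cochain.cup, cupMultilinear_apply, map_pair_zero_left, map_pair_zero_right]

theorem cupHom {N : Type u} [AddCommGroup N] [Module K N]
    (b : N →ₗ[K] MultilinearMap K (fun _ : Fin 2 => V) V) {n : ℕ}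
    (p : (free (regularSwap K N)).obj n) : IsLocalDG (opOf (cupHom b) n p) := by
  induction p using free.induction with
  | zero n => rw [map_zero]; exact zero
  | add p q hp hq => rw [map_add]; exact hp.add hq
  | smul c p hp => rw [map_smul]; exact hp.smul c
  | gen x => exact (cupMultilinear _).add ((cupMultilinear _).domDomCongr _)
  | act e p hp =>
    have : opOf (SymOperad.cupHom b) _ ((free _).act e p) =
        (opOf (SymOperad.cupHom b) _ p).domDomCongr e :=
      MultilinearMap.ext (opOf_act _ e p)
    rw [this]; exact hp.domDomCongr e
  | one =>
    have : opOf (SymOperad.cupHom b) 1 (free (regularSwap K N)).one =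
        MultilinearMap.ofSubsingleton K _ _ 0 LinearMap.id :=
      MultilinearMap.ext (opOf_one _)
    rw [this]; exact ofSubsingleton
  | comp p q hp hq =>
    have : opOf (SymOperad.cupHom b) _ ((free _).comp p q) =
        SymOperad.insertLast (opOf (SymOperad.cupHom b) _ p)
          (opOf (SymOperad.cupHom b) _ q) :=
      MultilinearMap.ext (opOf_comp _ p q)
    rw [this]; exact hp.insertLast hq

end IsLocalDG
end LocalDG

/-! ### Local dg algebras as plain algebras: the signs are trivial -/

section Signs

/-- At most one degree is nonzero, so every exponent `a (e i) * a (e j)` is zero. -/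
theorem koszulSign_eq_one {m n : ℕ} (e : Fin m ≃ Fin n) {a : Fin n → ℕ} (ha : ∑ i, a i < 2) :
    koszulSign e a = 1 := by
  refine Finset.prod_eq_one fun i _ => Finset.prod_eq_one fun j _ => ?_
  split_ifs with h
  · have hne : e i ≠ e j := fun h' => h.1.ne (e.injective h')
    have hle : a (e i) + a (e j) ≤ ∑ k, a k := by
      rw [← Finset.sum_pair hne]
      exact Finset.sum_le_sum_of_subset (Finset.subset_univ _)
    have : a (e i) * a (e j) = 0 := by
      rcases Nat.eq_zero_or_pos (a (e i)) with h0 | h0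
      · rw [h0, zero_mul]
      · rw [show a (e j) = 0 by omega, mul_zero]
    rw [this, pow_zero]
  · rfl

end Signs

section LocalAlgebras
variable {V : Type u} [AddCommGroup V] [Module K V] {Q : SymOperad K}

namespace Cochain

/-- The product `c ⊗ x` of a scalar cochain and of a coefficient. -/
def tmul : Cochain K →ₗ[K] V →ₗ[K] Cochain V :=
  LinearMap.mk₂ K (fun c x => (fun i => c.1 i • x, c.2 • x))
    (fun _ _ _ => by ext <;> simp [add_smul])
    (fun _ _ _ => by ext <;> simp [mul_smul])
    (fun _ _ _ => by ext <;> simp)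
    (fun r _ _ => by ext <;> exact smul_comm _ r _)

theorem tmul_apply (c : Cochain K) (x : V) : tmul c x = (fun i => c.1 i • x, c.2 • x) := rfl

variable (K) in
/-- The two vertices and the edge. -/
def cell : Fin 3 → Cochain K := ![(![1, 0], 0), (0, 1), (![0, 1], 0)]

/-- The coefficients of a cochain. -/
def coeff (c : Cochain V) : Fin 3 → V := ![c.1 0, c.2, c.1 1]

theorem sum_cell (c : Cochain V) : ∑ k, tmul (cell K k) (coeff c k) = c := by
  rw [Fin.sum_univ_three]
  ext i
  · fin_cases i <;> simp [tmul_apply, cell, coeff]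
  · simp [tmul_apply, cell, coeff]

theorem tmul_cell_mem (k : Fin 3) (x : V) :
    tmul (cell K k) x ∈ grade K V ((![0, 1, 0] : Fin 3 → ℕ) k) := by
  fin_cases k
  · exact mem_grade_zero.2 (by simp [tmul_apply, cell])
  · exact mem_grade_one.2 (by ext; simp [tmul_apply, cell])
  · exact mem_grade_zero.2 (by simp [tmul_apply, cell])

/-- Multilinear maps on cochains are determined by their values on the products of the cells and
of coefficients. -/
theorem multilinear_ext {n : ℕ} {W : Type*} [AddCommGroup W] [Module K W]
    {f g : MultilinearMap K (fun _ : Fin n => Cochain V) W}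
    (h : ∀ (k : Fin n → Fin 3) (x : Fin n → V), (f fun i => tmul (cell K (k i)) (x i)) =
      g fun i => tmul (cell K (k i)) (x i)) : f = g := by
  ext v
  have hv : v = fun i => ∑ k, tmul (cell K k) (coeff (v i) k) :=
    funext fun i => (sum_cell (v i)).symm
  rw [hv, f.map_sum, g.map_sum]
  exact Finset.sum_congr rfl fun r _ => h r fun i => coeff (v i) (r i)

end Cochain

/-- A morphism to the endomorphism operad of `C^*(Δ₁; V)` whose values satisfy `IsLocalDG` is a local
dg algebra structure: all signs are trivial, since products of cochains of total degree at least two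
vanish. -/
def localDGOfHom (f : Q ⟶ endOperad (K := K) (Cochain V))
    (hf : ∀ {n} (p : Q.obj n), IsLocalDG (opOf f n p)) : LocalDGAlgebra V Q where
  op := opOf f
  op_one := opOf_one f
  op_comp := opOf_comp f
  op_act {m n} e p v a hv := by
    rw [opOf_act]
    rcases lt_or_ge (∑ i, a i) 2 with h | h
    · simp [koszulSign_eq_one e h]
    · have h0 := (hf p).mem (fun i => v (e i)) (fun i => a (e i)) fun i => hv (e i)
      rw [Equiv.sum_comp e a] at h0
      rw [Cochain.eq_zero_of_mem h h0, smul_zero]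
  op_mem p := (hf p).mem
  leibniz {n} p v a hv := by
    -- In total degree zero this is the rule of `IsLocalDG`. In positive total degree all terms on
    -- both sides have degree at least two, hence vanish.
    rcases Nat.eq_zero_or_pos (∑ i, a i) with h | h
    · have ha : ∀ i, a i = 0 := by simpa using h
      simp only [ha] at hv
      simp [(hf p).leibniz v hv, ha]
    · rw [Cochain.eq_zero_of_mem (by omega) (Cochain.d_mem ((hf p).mem v a hv))]
      refine (Finset.sum_eq_zero fun i _ => ?_).symm
      have := (hf p).mem (Function.update v i (Cochain.d K V (v i)))
        (Function.update a i (a i + 1)) fun j => by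
          rcases eq_or_ne j i with rfl | hj
          · simpa using Cochain.d_mem (hv j)
          · simpa [hj] using hv j
      rw [Cochain.eq_zero_of_mem ?_ this, smul_zero]
      rw [Finset.sum_update_of_mem (Finset.mem_univ i)]
      have := Finset.add_sum_erase _ a (Finset.mem_univ i)
      rw [Finset.sdiff_singleton_eq_erase]
      omega
  isIdeal_relative X := {
    -- A differential vanishes on the vertices, so it lies in every relative complex.
    d_mem := fun {x} hx i _ => rfl
    op_mem := fun p v i hi => (hf p).relative X v i hi }

/-- A local dg algebra structure on `C^*(Δ₁; V)` is a morphism to the endomorphism operad. -/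
def LocalDGAlgebra.toHom (θ : LocalDGAlgebra V Q) : Q ⟶ endOperad (K := K) (Cochain V) where
  app := θ.op
  map_act {m n} e p := by
    -- The sign rule is available only for homogeneous inputs; products of cells with coefficients
    -- are homogeneous and suffice by multilinearity.
    refine Cochain.multilinear_ext fun k x => ?_
    have hv := fun i => Cochain.tmul_cell_mem (K := K) (k i) (x i)
    refine (θ.op_act e p _ _ hv).trans ?_
    change _ = θ.op m p _
    rcases lt_or_ge (∑ i, (![0, 1, 0] : Fin 3 → ℕ) (k i)) 2 with h | h
    · simp [koszulSign_eq_one e h]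
    · have h0 := θ.op_mem p _ _ fun i => hv (e i)
      rw [Equiv.sum_comp e fun i => (![0, 1, 0] : Fin 3 → ℕ) (k i)] at h0
      rw [Cochain.eq_zero_of_mem h h0, smul_zero]
  map_one := MultilinearMap.ext θ.op_one
  map_comp p q := MultilinearMap.ext (θ.op_comp p q)

end LocalAlgebras

/-! ### The algebra structure over `assCirc P` given by cup products -/

section CupAlgebra
variable {V : Type u} [AddCommGroup V] [Module K V] {P : SymOperad K}

theorem isCup_localDGOfHom_cupHom (A : P ⟶ endOperad V) :
    (localDGOfHom (cupHom (opOf A 2)) (IsLocalDG.cupHom _)).IsCup A (cupGen P) := by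
  intro μ a b
  refine (cupHom_gen (opOf A 2) (μ, 0) ![a, b]).trans ?_
  rw [map_zero]
  have : Cochain.cup (fun y z : V => (0 : MultilinearMap K (fun _ : Fin 2 => V) V) ![y, z])
    (![a, b] 1) (![a, b] 0) = 0 := by ext <;> simp [Cochain.cup]
  exact (congrArg _ this).trans (add_zero _)

/-- The cup products determine the algebra structure over the free operad. -/
theorem toHom_eq_cupHom {A : P ⟶ endOperad V}
    {θ : LocalDGAlgebra V (free (regularSwap K (P.obj 2)))} (h : θ.IsCup A (cupGen P)) :
    θ.toHom = cupHom (opOf A 2) := by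
  have h1 : ∀ μ, θ.toHom.app 2 (cupGen P μ) = (cupHom (opOf A 2)).app 2 (cupGen P μ) := by
    intro μ
    refine MultilinearMap.ext fun v => ?_
    have hv : v = ![v 0, v 1] := funext fun i => by fin_cases i <;> rfl
    rw [hv]
    exact (h μ _ _).trans (isCup_localDGOfHom_cupHom A μ _ _).symm
  refine free.hom_ext fun x => ?_
  -- `IsCup` prescribes only the generators `(μ, 0)`; equivariance under the transposition gives the
  -- others.
  have hx : free.gen (regularSwap K (P.obj 2)) x =
      cupGen P x.1 + (free (regularSwap K (P.obj 2))).act (Equiv.swap 0 1) (cupGen P x.2) := by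
    rw [cupGen, cupGen, free.act_swap_gen, ← map_add]
    congr 1
    ext <;> simp [regularSwap]
  rw [hx, map_add, map_add, Hom.map_act, Hom.map_act, h1, h1]

/-- The definition quantifies over all local dg structures extending the cup products. There is
exactly one such action, `cupHom`, so the quantifier disappears. -/
theorem mem_assCircRel {R : (free (regularSwap K (P.obj 2))).obj 3} :
    R ∈ assCircRel P ↔ ∀ (V : Type u) [AddCommGroup V] [Module K V] (A : P ⟶ endOperad V),
      opOf (cupHom (opOf A 2)) 3 R = 0 := by
  constructor
  · intro h V _ _ A
    exact h V A _ (isCup_localDGOfHom_cupHom A)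
  · intro h V _ _ A θ hθ
    have := h V A
    rwa [← toHom_eq_cupHom hθ] at this

/-- The algebra structure given by the cup products. -/
def assCircHom (A : P ⟶ endOperad V) : assCirc P ⟶ endOperad (K := K) (Cochain V) :=
  quotient.lift (cupHom (opOf A 2)) fun _ hR => mem_assCircRel.1 hR V A

/-- The relations of `assCirc P` act by zero by definition, so the action descends to the quotient.
Each operation there lifts to the free operad, from which it inherits `IsLocalDG`. -/
theorem exists_isCup (A : P ⟶ endOperad V) :
    ∃ θ : LocalDGAlgebra V (assCirc P), θ.IsCup A (assCircCup P) := by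
  refine ⟨localDGOfHom (assCircHom A) fun {n} p => ?_, isCup_localDGOfHom_cupHom A⟩
  obtain ⟨p, rfl⟩ := Submodule.Quotient.mk_surjective _ p
  exact IsLocalDG.cupHom (opOf A 2) p

end CupAlgebra

/-! ### A faithful algebra: the multilinear part of the free algebra on three generators -/

section Multilinear

theorem comp_swap (P : SymOperad K) (x y : P.obj 2) :
    P.comp (m := 1) (n := 2) x (P.swap y) =
      P.act (Equiv.swap (1 : Fin 3) 2) (P.comp (m := 1) (n := 2) x y) := by
  have h := P.comp_act (Equiv.refl (Fin 1)) (Equiv.swap (0 : Fin 2) 1) x y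
  have h1 : finExtend (Equiv.refl (Fin 1)) = Equiv.refl (Fin 2) := by decide
  have h2 : finBlock (Equiv.refl (Fin 1)) (Equiv.swap (0 : Fin 2) 1) =
      Equiv.swap (1 : Fin 3) 2 := by decide
  rw [h1, h2, P.act_refl] at h
  exact h

/-- A permutation is uniquely a rotation preceded by the identity or by the exchange of `1` and `2`.
This matches the sum over all permutations in `ternary` with the sum over the outer generator `k` in
`product`. -/
theorem sum_perm_three {M : Type*} [AddCommMonoid M] (f : Equiv.Perm (Fin 3) → M) :
    ∑ σ, f σ = ∑ k, (f (Equiv.addLeft k) + f ((Equiv.swap 1 2).trans (Equiv.addLeft k))) := by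
  let g : Fin 3 × Fin 2 → Equiv.Perm (Fin 3) := fun x =>
    ![Equiv.addLeft x.1, (Equiv.swap 1 2).trans (Equiv.addLeft x.1)] x.2
  have hg : Function.Bijective g := by decide
  rw [← hg.sum_comp f, Fintype.sum_prod_type]
  simp [g, Fin.sum_univ_two]

variable (P : SymOperad K)

/-- The part of the free `P`-algebra on three generators spanned by the operations in which every
generator occurs at most once. The component `k` of the second factor consists of the binary operations
in the generators `k + 1` and `k + 2`. -/
abbrev MultilinearFree : Type u := (Fin 3 → K) × (Fin 3 → P.obj 2) × P.obj 3

namespace MultilinearFree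
variable {P}

/-- The binary operations of `MultilinearFree P`. -/
def product (x : P.obj 2) : MultilinearFree P →ₗ[K] MultilinearFree P →ₗ[K] MultilinearFree P :=
  -- Products in which a generator repeats are set to zero. In the cubic part the generator `k`
  -- multiplies a binary operation in the other two, from the left or from the right; the rotation
  -- by `k` renames the inputs `0, 1, 2` to `k, k + 1, k + 2`.
  LinearMap.mk₂ K (fun u w => (0,
      fun k => (u.1 (k + 1) * w.1 (k + 2)) • x + (u.1 (k + 2) * w.1 (k + 1)) • P.swap x,
      ∑ k, P.act (Equiv.addLeft k) (u.1 k • P.comp (m := 1) (n := 2) x (w.2.1 k) +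
        w.1 k • P.comp (m := 1) (n := 2) (P.swap x) (u.2.1 k))))
    (fun u u' w => by
      refine Prod.ext (by simp) (Prod.ext (funext fun k => ?_) ?_)
      · simp only [Prod.fst_add, Prod.snd_add, Pi.add_apply]; module
      · simp only [Prod.fst_add, Prod.snd_add, Pi.add_apply, map_add, ← Finset.sum_add_distrib]
        refine Finset.sum_congr rfl fun k _ => ?_
        simp only [map_smul, map_add]; module)
    (fun c u w => by
      refine Prod.ext (by simp) (Prod.ext (funext fun k => ?_) ?_)
      · simp only [Prod.smul_fst, Prod.smul_snd, Pi.smul_apply, smul_eq_mul]; module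
      · simp only [Prod.smul_fst, Prod.smul_snd, Pi.smul_apply, map_smul, map_add,
          Finset.smul_sum, smul_eq_mul]
        refine Finset.sum_congr rfl fun k _ => ?_
        module)
    (fun u w w' => by
      refine Prod.ext (by simp) (Prod.ext (funext fun k => ?_) ?_)
      · simp only [Prod.fst_add, Prod.snd_add, Pi.add_apply]; module
      · simp only [Prod.fst_add, Prod.snd_add, Pi.add_apply, map_add, ← Finset.sum_add_distrib]
        refine Finset.sum_congr rfl fun k _ => ?_
        simp only [map_smul, map_add]; module)
    (fun c u w => by
      refine Prod.ext (by simp) (Prod.ext (funext fun k => ?_) ?_)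
      · simp only [Prod.smul_fst, Prod.smul_snd, Pi.smul_apply, smul_eq_mul]; module
      · simp only [Prod.smul_fst, Prod.smul_snd, Pi.smul_apply, map_smul, map_add,
          Finset.smul_sum, smul_eq_mul]
        refine Finset.sum_congr rfl fun k _ => ?_
        module)

theorem product_apply (x : P.obj 2) (u w : MultilinearFree P) : product x u w = (0,
      fun k => (u.1 (k + 1) * w.1 (k + 2)) • x + (u.1 (k + 2) * w.1 (k + 1)) • P.swap x,
      ∑ k, P.act (Equiv.addLeft k) (u.1 k • P.comp (m := 1) (n := 2) x (w.2.1 k) +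
        w.1 k • P.comp (m := 1) (n := 2) (P.swap x) (u.2.1 k))) := rfl

theorem product_swap (x : P.obj 2) (u w : MultilinearFree P) :
    product (P.swap x) u w = product x w u := by
  refine Prod.ext rfl (Prod.ext (funext fun k => ?_) ?_)
  · simp only [product_apply, swap_swap]; module
  · simp only [product_apply, swap_swap]
    exact Finset.sum_congr rfl fun k _ => congrArg _ (add_comm _ _)

variable (P) in
/-- `product` as a linear map. -/
def productLinear : P.obj 2 →ₗ[K] (endOperad (K := K) (MultilinearFree P)).obj 2 where
  toFun x := ofBilinear (product x)
  map_add' x y := by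
    refine MultilinearMap.ext fun v => ?_
    change product (x + y) (v 0) (v 1) = product x (v 0) (v 1) + product y (v 0) (v 1)
    refine Prod.ext (by simp [product_apply]) (Prod.ext (funext fun k => ?_) ?_)
    · simp only [product_apply, Prod.snd_add, Prod.fst_add, Pi.add_apply, map_add]; module
    · simp only [product_apply, Prod.snd_add, map_add, ← Finset.sum_add_distrib]
      refine Finset.sum_congr rfl fun k _ => ?_
      simp only [map_smul, map_add, LinearMap.add_apply]; module
  map_smul' c x := by
    refine MultilinearMap.ext fun v => ?_
    change product (c • x) (v 0) (v 1) = c • product x (v 0) (v 1)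
    refine Prod.ext (by simp [product_apply]) (Prod.ext (funext fun k => ?_) ?_)
    · simp only [product_apply, Prod.smul_snd, Prod.smul_fst, Pi.smul_apply, map_smul]; module
    · simp only [product_apply, Prod.smul_snd, Finset.smul_sum]
      refine Finset.sum_congr rfl fun k _ => ?_
      simp only [map_smul, map_add, LinearMap.smul_apply]; module

variable (P) in
/-- The ternary operations of `MultilinearFree P`. -/
def ternary : P.obj 3 →ₗ[K] MultilinearMap K (fun _ : Fin 3 => MultilinearFree P)
    (MultilinearFree P) where
  toFun p := ∑ σ : Equiv.Perm (Fin 3),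
    ((MultilinearMap.mkPiAlgebra K (Fin 3) K).compLinearMap fun i =>
      (LinearMap.proj (σ i)).comp (LinearMap.fst K (Fin 3 → K) ((Fin 3 → P.obj 2) × P.obj 3))).smulRight
        ((0, 0, P.act σ p) : MultilinearFree P)
  map_add' p q := by
    rw [← Finset.sum_add_distrib]
    refine Finset.sum_congr rfl fun σ _ => ?_
    ext v <;> simp
  map_smul' c p := by
    rw [Finset.smul_sum]
    refine Finset.sum_congr rfl fun σ _ => ?_
    ext v <;> simp [smul_comm c]

theorem ternary_apply (p : P.obj 3) (v : Fin 3 → MultilinearFree P) :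
    ternary P p v = (0, 0, ∑ σ : Equiv.Perm (Fin 3), (∏ i, (v i).1 (σ i)) • P.act σ p) := by
  simp only [ternary, LinearMap.coe_mk, AddHom.coe_mk, sum_apply]
  refine Prod.ext ?_ (Prod.ext ?_ ?_) <;> simp [Prod.fst_sum, Prod.snd_sum]

theorem ternary_act (e : Fin 3 ≃ Fin 3) (p : P.obj 3) (v : Fin 3 → MultilinearFree P) :
    ternary P (P.act e p) v = ternary P p fun i => v (e i) := by
  rw [ternary_apply, ternary_apply]
  refine Prod.ext rfl (Prod.ext rfl ?_)
  refine Fintype.sum_equiv (Equiv.mulRight (e : Equiv.Perm (Fin 3)))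
    (fun σ => (∏ i, (v i).1 (σ i)) • P.act σ (P.act e p))
    (fun σ => (∏ i, (v (e i)).1 (σ i)) • P.act σ p) fun σ => ?_
  rw [← P.act_trans, ← Equiv.prod_comp e]
  rfl

/-- The inner product has no linear part, so the outer one only pairs generators in `v 0` with
quadratic terms. For each outer generator `k` the two orders of the inner factors are the two
permutations of `sum_perm_three`, and `comp_swap` identifies the operations. -/
theorem product_product (x y : P.obj 2) (v : Fin 3 → MultilinearFree P) :
    product x (v 0) (product y (v 1) (v 2)) =
      ternary P (P.comp (m := 1) (n := 2) x y) v := by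
  rw [ternary_apply]
  refine Prod.ext rfl (Prod.ext (funext fun k => by simp [product_apply]) ?_)
  refine Eq.trans ?_ (sum_perm_three fun σ => (∏ i, (v i).1 (σ i)) •
    P.act σ (P.comp (m := 1) (n := 2) x y)).symm
  simp only [product_apply]
  refine Finset.sum_congr rfl fun k _ => ?_
  rw [P.act_trans, ← comp_swap, Fin.prod_univ_three, Fin.prod_univ_three]
  have h0 : (Equiv.swap (1 : Fin 3) 2) 0 = 0 := by decide
  simp [smul_smul, mul_assoc, h0]

/-- Evaluated at the three generators, only the identity permutation contributes, and the operation
itself is recovered. This is the source of faithfulness. -/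
theorem ternary_single (p : P.obj 3) :
    ternary P p (fun i => (Pi.single i 1, 0, 0)) = (0, 0, p) := by
  rw [ternary_apply, Finset.sum_eq_single 1]
  · simp
    exact P.act_refl p
  · intro σ _ hσ
    obtain ⟨i, hi⟩ : ∃ i, σ i ≠ i := by
      by_contra! h
      exact hσ (Equiv.ext h)
    rw [Finset.prod_eq_zero (Finset.mem_univ i), zero_smul]
    simp [hi]
  · simp

end MultilinearFree

variable {E : Type u} [AddCommGroup E] [Module K E]

/-- The binary products on `MultilinearFree` define an action of the free operad whose arity 3 part
factors through `P(3)`. Hence the relations act by zero, which is all that a quadratic operad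
requires, and by `ternary_single` an operation in `P(3)` is read off from its value at the
generators. -/
theorem exists_faithful_quadratic (τ : E →ₗ[K] E) (R : Submodule K ((free τ).obj 3)) :
    ∃ (V : Type u) (_ : AddCommGroup V) (_ : Module K V) (A : quadratic τ R ⟶ endOperad V)
      (x : Fin 3 → V), ∀ p, opOf A 3 p x = 0 → p = 0 := by
  let P := quadratic τ R
  let π : free τ ⟶ P := quotient.proj _
  let Φ : free τ ⟶ endOperad (K := K) (MultilinearFree P) :=
    free.lift ((MultilinearFree.productLinear P).comp (quadratic.gen τ R)) fun x => by
      refine MultilinearMap.ext fun v => ?_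
      have h : quadratic.gen τ R (τ x) = P.swap (quadratic.gen τ R x) :=
        congrArg (π.app 2) (free.act_swap_gen τ x).symm
      exact (congrArg (fun y => MultilinearFree.product y (v 0) (v 1)) h).trans
        (MultilinearFree.product_swap _ _ _)
  -- By `ternary_ext` it is enough to compare renamed composites of two generators, which is
  -- `product_product`.
  have hΦ : opOf Φ 3 = (MultilinearFree.ternary P).comp (π.app 3) := by
    refine ternary_ext fun e x y => MultilinearMap.ext fun v => ?_
    rw [opOf_act, opOf_comp_two, LinearMap.comp_apply, π.map_act, MultilinearFree.ternary_act]
    exact MultilinearFree.product_product _ _ fun i => v (e i)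
  let A : P ⟶ endOperad (K := K) (MultilinearFree P) := quotient.lift Φ fun r hr => by
    refine (LinearMap.congr_fun hΦ r).trans ?_
    have : π.app 3 r = 0 := (Submodule.Quotient.mk_eq_zero _).2 (subset_ideal _ _ hr)
    rw [LinearMap.comp_apply, this, map_zero]
    rfl
  refine ⟨_, _, _, A, fun i => (Pi.single i 1, 0, 0), fun p hp => ?_⟩
  obtain ⟨z, rfl⟩ := Submodule.Quotient.mk_surjective _ p
  have h1 : opOf Φ 3 z (fun i => (Pi.single i 1, 0, 0)) = 0 := hp
  rw [hΦ, LinearMap.comp_apply, MultilinearFree.ternary_single] at h1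
  exact congrArg (fun u : MultilinearFree P => u.2.2) h1

/-- Binary quadratic operads have algebras on which nonzero ternary operations act nontrivially. -/
theorem IsBinaryQuadratic.exists_faithful {P : SymOperad K} (hP : P.IsBinaryQuadratic) :
    ∃ (V : Type u) (_ : AddCommGroup V) (_ : Module K V) (A : P ⟶ endOperad V)
      (x : Fin 3 → V), ∀ p, opOf A 3 p x = 0 → p = 0 := by
  obtain ⟨E, _, _, _, τ, _, R, ⟨f⟩⟩ := hP
  obtain ⟨V, _, _, A, x, h⟩ := exists_faithful_quadratic τ R
  refine ⟨V, _, _, f.hom ≫ A, x, fun p hp => ?_⟩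
  have h0 : f.hom.app 3 p = 0 := h _ hp
  have h1 : f.inv.app 3 (f.hom.app 3 p) = p :=
    LinearMap.congr_fun (congrFun (congrArg Hom.app f.hom_inv_id) 3) p
  rw [← h1, h0, map_zero]

end Multilinear

/-! ### The associative operad and its action on scalar cochains -/

section Associative
open Cochain

variable (K) in
/-- The multiples of the multiplication of `K`. -/
def scalarProduct : K →ₗ[K] MultilinearMap K (fun _ : Fin 2 => K) K :=
  LinearMap.toSpanSingleton K _ (ofBilinear (LinearMap.mul K K))

theorem scalarProduct_apply (c : K) (v : Fin 2 → K) : scalarProduct K c v = c * (v 0 * v 1) := rfl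

theorem opOf_assProduct (v : Fin 2 → Cochain K) :
    opOf (cupHom (scalarProduct K)) 2 (assProduct K) v = cup (· * ·) (v 0) (v 1) := by
  refine (cupHom_gen _ _ v).trans ?_
  ext <;> simp [cup, scalarProduct_apply]

/-- The cup product is associative: on the edge both bracketings of `a, b, c` give `a₀b₀c + a₀bc₁ +
ab₁c₁`, where indices denote vertex values and bare letters edge values. -/
theorem opOf_assRelator : opOf (cupHom (scalarProduct K)) 3 (assRelator K) = 0 := by
  refine MultilinearMap.ext fun v => ?_
  rw [assRelator, map_sub]
  change opOf _ 3 ((free (regularSwap K K)).act (finAddFlip (m := 1) (n := 2)) _) v -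
    opOf _ 3 _ v = 0
  rw [opOf_act, sub_eq_zero]
  refine (opOf_comp_two _ _ _ _).trans (Eq.trans ?_ (opOf_comp_two _ _ _ _).symm)
  rw [opOf_swap, opOf_assProduct, opOf_assProduct, opOf_assProduct, opOf_assProduct]
  -- This renaming turns `(x₁ x₂) x₀` into `(x₀ x₁) x₂`.
  have h0 : finAddFlip (m := 1) (n := 2) (0 : Fin 3) = (2 : Fin 3) := by decide
  have h1 : finAddFlip (m := 1) (n := 2) (1 : Fin 3) = (0 : Fin 3) := by decide
  have h2 : finAddFlip (m := 1) (n := 2) (2 : Fin 3) = (1 : Fin 3) := by decide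
  simp only [h0, h1, h2]
  ext
  · simp [cup, mul_assoc]
  · simp [cup]; ring

variable (K) in
/-- The scalar cochains form an associative algebra. -/
def assCochain : assOperad K ⟶ endOperad (K := K) (Cochain K) :=
  quotient.lift (cupHom (scalarProduct K)) fun r hr => by
    obtain ⟨c, rfl⟩ := Submodule.mem_span_singleton.1 hr
    rw [map_smul]
    exact (congrArg (c • ·) opOf_assRelator).trans (smul_zero c)

variable (K) in
/-- The product of the associative operad, as an element of `assOperad K`. -/
def assMul : (assOperad K).obj 2 := assCup K

theorem opOf_assMul (v : Fin 2 → Cochain K) :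
    opOf (assCochain K) 2 (assMul K) v = cup (· * ·) (v 0) (v 1) := opOf_assProduct v

variable (K) in
/-- The generators of the associative operad. -/
def assGen : K × K →ₗ[K] (assOperad K).obj 2 := quadratic.gen (regularSwap K K) (K ∙ assRelator K)

theorem assGen_eq (x : K × K) : assGen K x =
    x.1 • assMul K + x.2 • (assOperad K).swap (assMul K) := by
  have h : (assOperad K).swap (assMul K) =
      assGen K (0, 1) :=
    congrArg ((quotient.proj _).app 2) (free.act_swap_gen (regularSwap K K) (1, 0))
  have h1 : assMul K = assGen K (1, 0) := rfl
  rw [h, h1, ← map_smul, ← map_smul, ← map_add]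
  congr 1
  ext <;> simp

variable (K) in
/-- The product of three factors in the associative operad. -/
def assTriple : (assOperad K).obj 3 :=
  (assOperad K).comp (m := 1) (n := 2) (assMul K) (assMul K)

theorem assoc_assMul : (assOperad K).act (finAddFlip (m := 1) (n := 2))
    ((assOperad K).comp (m := 1) ((assOperad K).swap (assMul K)) (assMul K)) = assTriple K := by
  have h : (quotient.proj (P := free (regularSwap K K)) (K ∙ assRelator K)).app 3 (assRelator K) =
      0 := (Submodule.Quotient.mk_eq_zero _).2
        (subset_ideal _ _ (Submodule.mem_span_singleton_self _))
  rw [assRelator, map_sub, sub_eq_zero] at h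
  exact h

/-- Associativity as a rewriting rule: `(x₁ x₂) x₀ = x₁ (x₂ x₀)`. Together with `comp_swap` it turns
every composite of the product and its opposite into a renamed `assTriple`. -/
theorem comp_swap_assMul : (assOperad K).comp (m := 1) (n := 2) ((assOperad K).swap (assMul K))
    (assMul K) = (assOperad K).act (finAddFlip (m := 1) (n := 2)).symm (assTriple K) := by
  rw [← assoc_assMul, ← (assOperad K).act_trans, Equiv.self_trans_symm, (assOperad K).act_refl]

/-- The ternary operations of the associative operad are spanned by the products of the three inputs in
all orders. -/
theorem span_assTriple : Submodule.span K (Set.range fun e : Equiv.Perm (Fin 3) =>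
    (assOperad K).act e (assTriple K)) = ⊤ := by
  refine Submodule.eq_top_iff'.2 fun p => ?_
  set S := Submodule.span K (Set.range fun e : Equiv.Perm (Fin 3) =>
    (assOperad K).act e (assTriple K))
  have hT : ∀ e : Equiv.Perm (Fin 3), (assOperad K).act e (assTriple K) ∈ S :=
    fun e => Submodule.subset_span ⟨e, rfl⟩
  obtain ⟨z, rfl⟩ := Submodule.Quotient.mk_surjective _ p
  let π : free (regularSwap K K) ⟶ assOperad K := quotient.proj _
  change z ∈ S.comap (π.app 3)
  induction mem_ternarySpan z using Submodule.span_induction with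
  | zero => exact Submodule.zero_mem _
  | add p q _ _ hp hq => exact Submodule.add_mem _ hp hq
  | smul c p _ hp => exact Submodule.smul_mem _ c hp
  | mem z hz =>
    obtain ⟨e, x, y, rfl⟩ := hz
    have h : π.app 3 ((free (regularSwap K K)).act e ((free (regularSwap K K)).comp (m := 1) (n := 2)
        (free.gen _ x) (free.gen _ y))) = (assOperad K).act e ((assOperad K).comp (m := 1) (n := 2)
          (assGen K x)
          (assGen K y)) := rfl
    refine Submodule.mem_comap.2 ?_
    -- Each generator is a combination of the product and its opposite, so four composites have to
    -- be rewritten.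
    rw [h, assGen_eq, assGen_eq]
    have h00 : (assOperad K).comp (m := 1) (n := 2) (assMul K) (assMul K) = assTriple K := rfl
    simp only [map_add, map_smul, LinearMap.add_apply, LinearMap.smul_apply, comp_swap,
      comp_swap_assMul, h00, ← (assOperad K).act_trans]
    have hadd := fun {x y} => @Submodule.add_mem _ _ _ _ _ S x y
    have hsmul := fun c {x} => @Submodule.smul_mem _ _ _ _ _ S x c
    exact hadd (hsmul _ (hadd (hsmul _ (hT _)) (hsmul _ (hT _))))
      (hsmul _ (hadd (hsmul _ (hT _)) (hsmul _ (hT _))))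

/-- The left vertex acts as a left unit on the edge and the right vertex as a right unit. The edge
followed by the left vertex, the right vertex followed by the edge, and two distinct vertices
multiply to zero. So one order alone survives, which separates the six orders of the triple product.
-/
theorem opOf_assTriple_cell (σ : Equiv.Perm (Fin 3)) :
    opOf (assCochain K) 3 (assTriple K) (fun i => cell K (σ i)) =
      if σ = 1 then cell K 1 else 0 := by
  rw [assTriple]
  refine Eq.trans (opOf_comp_two (assCochain K) (assMul K) (assMul K) _) ?_
  rw [opOf_assMul, opOf_assMul]
  have h01 : σ 0 ≠ σ 1 := fun h => by simpa using σ.injective h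
  have h02 : σ 0 ≠ σ 2 := fun h => by simpa using σ.injective h
  have h12 : σ 1 ≠ σ 2 := fun h => by simpa using σ.injective h
  have hσ : σ = 1 ↔ σ 0 = 0 ∧ σ 1 = 1 ∧ σ 2 = 2 := by
    rw [Equiv.ext_iff, Fin.forall_fin_succ, Fin.forall_fin_succ, Fin.forall_fin_one]
    rfl
  simp only [hσ]
  generalize σ 0 = i at *
  generalize σ 1 = j at *
  generalize σ 2 = k at *
  clear hσ
  fin_cases i <;> fin_cases j <;> fin_cases k <;> simp at h01 h02 h12 <;>
    ext l <;> (try fin_cases l) <;> simp [cup, cell]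

variable (K) in
/-- The binary operations of the associative operad are spanned by the product and its opposite. -/
def assBinaryEquiv : (K × K) ≃ₗ[K] (assOperad K).obj 2 :=
  LinearEquiv.ofBijective (assGen K) <| by
    constructor
    · refine (injective_iff_map_eq_zero _).2 fun x hx => ?_
      have h : ∀ v : Fin 2 → Cochain K, cup (fun y z => scalarProduct K x.1 ![y, z]) (v 0) (v 1) +
          cup (fun y z => scalarProduct K x.2 ![y, z]) (v 1) (v 0) = 0 := fun v => by
        have h0 := congrArg (opOf (assCochain K) 2) hx
        exact congrArg (fun f : MultilinearMap K (fun _ : Fin 2 => Cochain K) (Cochain K) => f v)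
          (h0.trans (map_zero (opOf (assCochain K) 2)))
      -- Left vertex times edge is the edge, and the reverse product is zero; the two evaluations
      -- isolate the two coefficients.
      have h1 := congrArg Prod.snd (h ![cell K 0, cell K 1])
      have h2 := congrArg Prod.snd (h ![cell K 1, cell K 0])
      simp [cup, cell, scalarProduct_apply] at h1 h2
      exact Prod.ext h1 h2
    · intro p
      obtain ⟨q, rfl⟩ := Submodule.Quotient.mk_surjective _ p
      obtain ⟨x, rfl⟩ := mem_lowSpan _ q
      exact ⟨x, rfl⟩

end Associative

/-! ### Hadamard products acting on tensor products, and the matching of generators -/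

section Compare
open Cochain

section Evaluation
variable {V : Type u} [AddCommGroup V] [Module K V] {P Q : SymOperad K}

/-- The value of an operation in the Hadamard product on the products of scalar cochains and of
coefficients. -/
def evalTensor (B : Q ⟶ endOperad (K := K) (Cochain K)) (A : P ⟶ endOperad V) {n : ℕ}
    (c : Fin n → Cochain K) (x : Fin n → V) : (hadamard Q P).obj n →ₗ[K] Cochain V :=
  TensorProduct.lift (tmul.compl₁₂
    ({ toFun := fun q => opOf B n q c
       map_add' := fun p q => by rw [map_add]; rfl
       map_smul' := fun r q => by rw [map_smul]; rfl } : Q.obj n →ₗ[K] Cochain K)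
    ({ toFun := fun p => opOf A n p x
       map_add' := fun p q => by rw [map_add]; rfl
       map_smul' := fun r q => by rw [map_smul]; rfl } : P.obj n →ₗ[K] V))

variable (B : Q ⟶ endOperad (K := K) (Cochain K)) (A : P ⟶ endOperad V)

theorem evalTensor_tmul {n : ℕ} (c : Fin n → Cochain K) (x : Fin n → V) (q : Q.obj n)
    (p : P.obj n) : evalTensor B A c x (q ⊗ₜ[K] p) = tmul (opOf B n q c) (opOf A n p x) := rfl

theorem evalTensor_act {m n : ℕ} (e : Fin m ≃ Fin n) (c : Fin n → Cochain K) (x : Fin n → V)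
    (s : (hadamard Q P).obj m) : evalTensor B A c x ((hadamard Q P).act e s) =
      evalTensor B A (fun i => c (e i)) (fun i => x (e i)) s := by
  induction s using TensorProduct.induction_on with
  | zero =>
    exact (congrArg _ (map_zero ((hadamard Q P).act e))).trans ((map_zero _).trans (map_zero _).symm)
  | add s t hs ht =>
    exact (congrArg _ (map_add ((hadamard Q P).act e) s t)).trans
      ((map_add _ _ _).trans ((congrArg₂ _ hs ht).trans (map_add _ _ _).symm))
  | tmul q p =>
    change evalTensor B A c x (Q.act e q ⊗ₜ[K] P.act e p) = _
    rw [evalTensor_tmul, evalTensor_tmul, opOf_act, opOf_act]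

theorem evalTensor_comp_tmul {m n : ℕ} (c : Fin (m + n) → Cochain K) (x : Fin (m + n) → V)
    (s : (hadamard Q P).obj (m + 1)) (q : Q.obj n) (p : P.obj n) :
    evalTensor B A c x ((hadamard Q P).comp (m := m) (n := n) s (q ⊗ₜ[K] p)) =
      evalTensor B A (Fin.snoc (α := fun _ => Cochain K) (fun i => c (Fin.castAdd n i))
          (opOf B n q fun j => c (Fin.natAdd m j)))
        (Fin.snoc (α := fun _ => V) (fun i => x (Fin.castAdd n i))
          (opOf A n p fun j => x (Fin.natAdd m j))) s := by
  induction s using TensorProduct.induction_on with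
  | zero =>
    exact (congrArg _ (LinearMap.map_zero₂ ((hadamard Q P).comp (m := m) (n := n)) _)).trans
      ((map_zero _).trans (map_zero _).symm)
  | add s t hs ht =>
    exact (congrArg _ (LinearMap.map_add₂ ((hadamard Q P).comp (m := m) (n := n)) s t _)).trans
      ((map_add _ _ _).trans ((congrArg₂ _ hs ht).trans (map_add _ _ _).symm))
  | tmul a b =>
    rw [hadamard_comp_tmul, evalTensor_tmul, evalTensor_tmul, opOf_comp, opOf_comp]

theorem tmul_snoc {n : ℕ} (c : Fin n → Cochain K) (x : Fin n → V) (d : Cochain K) (y : V) :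
    (Fin.snoc (α := fun _ => Cochain V) (fun i => tmul (c i) (x i)) (tmul d y)) =
      fun i => tmul (Fin.snoc (α := fun _ => Cochain K) c d i)
        (Fin.snoc (α := fun _ => V) x y i) := by
  funext i
  induction i using Fin.lastCases with
  | last => simp only [Fin.snoc_last]
  | cast i => simp only [Fin.snoc_castSucc]

/-- The composition step of `cupHom_tmul`. The inner value need not be a pure product `c ⊗ y`, so
the hypothesis on `f` is extended to it by linearity in the last argument. -/
theorem evalTensor_comp {m n : ℕ} {f : MultilinearMap K (fun _ : Fin (m + 1) => Cochain V) (Cochain V)}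
    {s : (hadamard Q P).obj (m + 1)}
    (hf : ∀ c x, (f fun i => tmul (c i) (x i)) = evalTensor B A c x s)
    (c : Fin (m + n) → Cochain K) (x : Fin (m + n) → V) (t : (hadamard Q P).obj n) :
    f (Fin.snoc (α := fun _ => Cochain V)
        (fun i => tmul (c (Fin.castAdd n i)) (x (Fin.castAdd n i)))
        (evalTensor B A (fun j => c (Fin.natAdd m j)) (fun j => x (Fin.natAdd m j)) t)) =
      evalTensor B A c x ((hadamard Q P).comp (m := m) (n := n) s t) := by
  change lastLinear f _ _ = _
  induction t using TensorProduct.induction_on with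
  | zero =>
    exact (congrArg _ (map_zero _)).trans ((map_zero _).trans
      ((congrArg _ (map_zero ((hadamard Q P).comp (m := m) (n := n) s))).trans (map_zero _)).symm)
  | add t u ht hu =>
    exact (congrArg _ (map_add _ t u)).trans ((map_add _ _ _).trans ((congrArg₂ _ ht hu).trans
      ((congrArg _ (map_add ((hadamard Q P).comp (m := m) (n := n) s) t u)).trans
        (map_add _ _ _)).symm))
  | tmul q p =>
    rw [evalTensor_comp_tmul, evalTensor_tmul, ← hf, ← tmul_snoc]
    rfl

end Evaluation

variable (P : SymOperad K)

/-- The action of the transposition as a linear equivalence. -/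
def swapEquiv : P.obj 2 ≃ₗ[K] P.obj 2 :=
  LinearEquiv.ofInvolutive P.swap P.swap_swap

/-- The isomorphism that sends `(μ, ν)` to the sum of the generator `∪ ⊗ μ` of the white product and of
the opposite of the generator `∪ ⊗ ν`. -/
def cupEquiv : (P.obj 2 × P.obj 2) ≃ₗ[K] (assOperad K).obj 2 ⊗[K] P.obj 2 :=
  (((TensorProduct.lid K (P.obj 2)).symm.prodCongr
    (P.swapEquiv.trans (TensorProduct.lid K (P.obj 2)).symm)).trans
    (TensorProduct.prodLeft K K K K (P.obj 2)).symm).trans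
    (TensorProduct.congr (assBinaryEquiv K) (LinearEquiv.refl K (P.obj 2)))

/-- The coefficient `x.2` is swapped because the opposite of `∪ ⊗ ν` is `∪^op ⊗ ν^op`. -/
theorem cupEquiv_apply (x : P.obj 2 × P.obj 2) : cupEquiv P x =
    assMul K ⊗ₜ[K] x.1 + (assOperad K).swap (assMul K) ⊗ₜ[K] P.swap x.2 := by
  have h : ∀ y, assBinaryEquiv K y = assGen K y := fun _ => rfl
  have h' : ∀ y, P.swapEquiv y = P.swap y := fun _ => rfl
  have hx : (TensorProduct.prodLeft K K K K (P.obj 2)).symm (1 ⊗ₜ[K] x.1, 1 ⊗ₜ[K] P.swap x.2) =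
      (1, 0) ⊗ₜ[K] x.1 + (0, 1) ⊗ₜ[K] P.swap x.2 := by
    rw [LinearEquiv.symm_apply_eq, map_add]
    simp
  simp only [cupEquiv, LinearEquiv.trans_apply, LinearEquiv.prodCongr_apply, h',
    TensorProduct.lid_symm_apply, hx, map_add, TensorProduct.congr_tmul, h, assGen_eq,
    LinearEquiv.refl_apply]
  simp

theorem cupEquiv_swap (x : P.obj 2 × P.obj 2) : cupEquiv P (regularSwap K (P.obj 2) x) =
    whiteSwap (assOperad K) P (cupEquiv P x) := by
  rw [cupEquiv_apply, cupEquiv_apply, map_add, whiteSwap, TensorProduct.map_tmul,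
    TensorProduct.map_tmul, swap_swap, swap_swap, add_comm]
  rfl

end Compare

/-! ### Equality of the ternary relations -/

section Relations
open Cochain
variable (P : SymOperad K)

/-- The morphism `∪ ⊗ μ ↦ ∪ ⊗ μ` to the Hadamard product. -/
def cupCompare : free (regularSwap K (P.obj 2)) ⟶ hadamard (assOperad K) P :=
  freeMap (cupEquiv P).toLinearMap (cupEquiv_swap P) ≫ whiteCompare (assOperad K) P

variable {P}
variable {V : Type u} [AddCommGroup V] [Module K V] (A : P ⟶ endOperad V)

theorem cup_tmul (f : MultilinearMap K (fun _ : Fin 2 => V) V) (c d : Cochain K) (x y : V) :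
    cup (fun y z => f ![y, z]) (tmul c x) (tmul d y) = tmul (cup (· * ·) c d) (f ![x, y]) := by
  simp only [cup, tmul_apply, map_pair_smul_left, map_pair_smul_right, smul_smul, add_smul, mul_comm]

/-- The action of the free operad by cup products factors through the Hadamard product. -/
theorem cupHom_tmul {n : ℕ} (z : (free (regularSwap K (P.obj 2))).obj n) (c : Fin n → Cochain K)
    (x : Fin n → V) : (opOf (cupHom (opOf A 2)) n z fun i => tmul (c i) (x i)) =
      evalTensor (assCochain K) A c x ((cupCompare P).app n z) := by
  induction z using free.induction with
  | zero n =>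
    rw [map_zero, map_zero]
    exact (map_zero _).symm
  | add p q hp hq =>
    rw [map_add, map_add]
    exact (congrArg₂ _ (hp c x) (hq c x)).trans (map_add _ _ _).symm
  | smul r p hp =>
    rw [map_smul, map_smul]
    exact (congrArg _ (hp c x)).trans (map_smul _ _ _).symm
  | gen y =>
    have hv : ∀ {M : Type u} (v : Fin 2 → M), ![v 0, v 1] = v :=
      fun v => funext fun i => by fin_cases i <;> rfl
    have h : (cupCompare P).app 2 (free.gen _ y) = assMul K ⊗ₜ[K] y.1 +
      (assOperad K).swap (assMul K) ⊗ₜ[K] P.swap y.2 := cupEquiv_apply P y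
    refine Eq.trans ?_ ((congrArg _ h).trans (map_add _ _ _)).symm
    refine Eq.trans ?_ (congrArg₂ (· + ·) (evalTensor_tmul (assCochain K) A c x _ _)
      (evalTensor_tmul (assCochain K) A c x _ _)).symm
    rw [opOf_swap, opOf_assMul, opOf_assMul, cupHom_gen, cup_tmul, cup_tmul, hv]
    rw [opOf_swap]
    rfl
  | act e p hp =>
    rw [opOf_act, Hom.map_act, evalTensor_act]
    exact hp _ _
  | one =>
    rw [opOf_one, Hom.map_one]
    refine Eq.trans ?_ (evalTensor_tmul _ _ _ _ _ _).symm
    rw [opOf_one, opOf_one]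
  | comp p q hp hq =>
    rw [opOf_comp, Hom.map_comp, hq]
    exact evalTensor_comp _ _ hp c x _

theorem cupHom_eq_zero {z : (free (regularSwap K (P.obj 2))).obj 3}
    (hz : (cupCompare P).app 3 z = 0) : opOf (cupHom (opOf A 2)) 3 z = 0 :=
  multilinear_ext fun k x => by
    rw [cupHom_tmul, hz]
    exact map_zero _

/-- The elements of `Ass(3) ⊗ P(3)` as combinations of the products in all orders. -/
theorem exists_sum_assTriple (s : (assOperad K).obj 3 ⊗[K] P.obj 3) :
    ∃ o : Equiv.Perm (Fin 3) → P.obj 3,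
      s = ∑ e, (assOperad K).act e (assTriple K) ⊗ₜ[K] o e := by
  induction s using TensorProduct.induction_on with
  | zero => exact ⟨0, by simp⟩
  | add s t hs ht =>
    obtain ⟨o, rfl⟩ := hs
    obtain ⟨o', rfl⟩ := ht
    exact ⟨o + o', by simp [TensorProduct.tmul_add, Finset.sum_add_distrib]⟩
  | tmul a p =>
    obtain ⟨r, rfl⟩ := (Submodule.mem_span_range_iff_exists_fun K).1
      (span_assTriple (K := K) ▸ Submodule.mem_top (x := a))
    exact ⟨fun e => r e • p, by simp [TensorProduct.sum_tmul, TensorProduct.smul_tmul]⟩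

/-- The cells detect the order of the associative factor and `x` detects the coefficient in `P(3)`.
Spanning by the triple products is enough: their linear independence is not invoked, since the cells
kill all orders but one. -/
theorem eq_zero_of_cupHom {A : P ⟶ endOperad V} {x : Fin 3 → V}
    (hA : ∀ p, opOf A 3 p x = 0 → p = 0) {z : (free (regularSwap K (P.obj 2))).obj 3}
    (hz : opOf (cupHom (opOf A 2)) 3 z = 0) : (cupCompare P).app 3 z = 0 := by
  obtain ⟨o, ho⟩ := exists_sum_assTriple ((cupCompare P).app 3 z)
  suffices h : ∀ e, o e = 0 by
    rw [ho]
    exact Finset.sum_eq_zero fun e _ => by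
      rw [h e, TensorProduct.tmul_zero]
      rfl
  intro e₀
  refine hA _ ?_
  -- The term `e` evaluates the triple product at the cells `e₀⁻¹ (e i)`, which are in the surviving
  -- order only for `e = e₀`.
  have h0 := cupHom_tmul A z (fun i => cell K (e₀.symm i)) x
  have h1 : evalTensor (assCochain K) A (fun i => cell K (e₀.symm i)) x
      (∑ e, (assOperad K).act e (assTriple K) ⊗ₜ[K] o e) = tmul (cell K 1) (opOf A 3 (o e₀) x) := by
    refine (map_sum _ _ _).trans ((Finset.sum_eq_single e₀ (fun e _ he => ?_) (by simp)).trans ?_)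
    · rw [evalTensor_tmul, opOf_act]
      have := opOf_assTriple_cell (K := K) (e.trans e₀.symm)
      rw [if_neg fun h => he ?_] at this
      · exact (congrArg₂ (fun c y => tmul (V := V) c y) this rfl).trans (LinearMap.map_zero₂ _ _)
      · ext i
        have := congrArg e₀ (Equiv.congr_fun h i)
        simpa using congrArg Fin.val this
    · rw [evalTensor_tmul, opOf_act]
      have := opOf_assTriple_cell (K := K) (e₀.trans e₀.symm)
      rw [if_pos (show e₀.trans e₀.symm = 1 from Equiv.self_trans_symm e₀)] at this
      exact congrArg₂ (fun c y => tmul (V := V) c y) this rfl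
  rw [hz] at h0
  have h2 := congrArg Prod.snd ((h0.trans (congrArg _ ho)).trans h1)
  simpa [tmul_apply, cell] using h2.symm

/-- Vanishing in the Hadamard product forces vanishing on all algebras; conversely, a single
faithful algebra suffices. Quadraticity of `P` serves to provide that algebra. -/
theorem mem_assCircRel_iff (hP : P.IsBinaryQuadratic)
    {z : (free (regularSwap K (P.obj 2))).obj 3} :
    z ∈ assCircRel P ↔ (cupCompare P).app 3 z = 0 := by
  rw [mem_assCircRel]
  constructor
  · intro h
    obtain ⟨V, _, _, A, x, hA⟩ := hP.exists_faithful
    exact eq_zero_of_cupHom hA (h V A)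
  · intro h V _ _ A
    exact cupHom_eq_zero A h

end Relations

/-! ### The natural isomorphism -/

section Iso
variable {P : SymOperad K} (hP : P.IsBinaryQuadratic)

theorem cupEquiv_symm_swap (x : (assOperad K).obj 2 ⊗[K] P.obj 2) :
    (cupEquiv P).symm (whiteSwap (assOperad K) P x) =
      regularSwap K (P.obj 2) ((cupEquiv P).symm x) := by
  rw [LinearEquiv.symm_apply_eq, cupEquiv_swap, LinearEquiv.apply_symm_apply]

/-- This carries the relations of the white product back to those of `assCirc P`, as the inverse
isomorphism requires. -/
theorem freeMap_symm_comp : freeMap (cupEquiv P).symm.toLinearMap cupEquiv_symm_swap ≫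
    cupCompare P = whiteCompare (assOperad K) P :=
  free.hom_ext fun x => (cupEquiv P).apply_symm_apply x

/-- The isomorphism `∪ ⊗ μ ↦ ∪ ⊗ μ` of `assCirc P` and the white product. -/
def assCircIso : assCirc P ≅ white (assOperad K) P where
  hom := quadraticMap (cupEquiv P).toLinearMap (cupEquiv_swap P) fun _ hr =>
    LinearMap.mem_ker.2 ((mem_assCircRel_iff hP).1 hr)
  inv := quadraticMap (cupEquiv P).symm.toLinearMap cupEquiv_symm_swap fun r hr =>
    (mem_assCircRel_iff hP).2 <|
      (LinearMap.congr_fun (congrFun (congrArg Hom.app freeMap_symm_comp) 3) r).trans hr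
  hom_inv_id := quadratic.hom_ext fun x =>
    congrArg (quadratic.gen _ _) ((cupEquiv P).symm_apply_apply x)
  inv_hom_id := quadratic.hom_ext fun x =>
    congrArg (quadratic.gen _ _) ((cupEquiv P).apply_symm_apply x)

theorem cupEquiv_naturality {P Q : SymOperad K} (f : P ⟶ Q) (x : P.obj 2 × P.obj 2) :
    cupEquiv Q (((f.app 2).prodMap (f.app 2)) x) =
      TensorProduct.map LinearMap.id (f.app 2) (cupEquiv P x) := by
  have h : f.app 2 (P.swap x.2) = Q.swap (f.app 2 x.2) := f.map_act _ _
  rw [cupEquiv_apply, cupEquiv_apply]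
  simp [h]

variable (K) in
/-- The natural isomorphism of `Ass_∘` and of the white product with the associative operad. -/
def assCircNatIso : assCircFunctor K ≅ whiteFunctor (Ass K) :=
  NatIso.ofComponents (fun P => ObjectProperty.isoMk _ (assCircIso P.property)) fun {P Q} f => by
    ext1
    -- Morphisms out of a quadratic operad are determined by the generators, so naturality is a
    -- statement about `cupEquiv` alone.
    exact quadratic.hom_ext fun x => congrArg (quadratic.gen _ _) (cupEquiv_naturality f.hom x)

theorem assCircNatIso_assCircCup (P : Op K) (μ : P.obj.obj 2) :
    ((assCircNatIso K).hom.app P).hom.app 2 (assCircCup P.obj μ) =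
      whiteGen (Ass K).obj P.obj (assCup K ⊗ₜ[K] μ) := by
  have h : cupEquiv P.obj (μ, 0) = assMul K ⊗ₜ[K] μ := by
    rw [cupEquiv_apply]; simp
  exact congrArg (whiteGen (assOperad K) P.obj) h

end Iso
end SymOperad

end

theorem theorem2p6 (K : Type u) [Field K] :
    -- the cup products make `C^*(Δ₁; V)` a local dg algebra over `Ass_∘(P)`
    (∀ (P : SymOperad.Op K) (V : Type u) [AddCommGroup V] [Module K V]
      (A : P.obj ⟶ SymOperad.endOperad V),
      ∃ θ : SymOperad.LocalDGAlgebra V (SymOperad.assCirc P.obj),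
        θ.IsCup A (SymOperad.assCircCup P.obj)) ∧
    -- the natural isomorphism, and its values on generators
    ∃ η : SymOperad.assCircFunctor K ≅ SymOperad.whiteFunctor (SymOperad.Ass K),
      ∀ (P : SymOperad.Op K) (μ : P.obj.obj 2),
        (η.hom.app P).hom.app 2 (SymOperad.assCircCup P.obj μ) =
          SymOperad.whiteGen (SymOperad.Ass K).obj P.obj (SymOperad.assCup K ⊗ₜ[K] μ) :=
  ⟨fun _ _ _ _ A => SymOperad.exists_isCup A,
    SymOperad.assCircNatIso K, SymOperad.assCircNatIso_assCircCup⟩
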